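/- \textbf{Definitions.} All codes are linear over a finite field $\mathbb F$; $[m]$ denotes $\{1,\dots,m\}$. For a word $x$ over a finite non-empty index set, $\|x\|$ is the fraction of its non-zero entries, and $\delta(x,D)=\min_{y\in D}\|x-y\|$ for a code $D$. Let $X=[n_1]\times\dots\times[n_m]$. For $I\subseteq[m]$, $\mathcal L_I$ is the set of axis-parallel flats of $X$ in the directions $I$ (the sets of all points whose coordinates outside $I$ have prescribed values), and $\mathcal L_i:=\mathcal L_{\{i\}}$ is the set of lines parallel to the $i$-th axis. For $x\in\mathbb F^{X}$, $\|x\|_i$ is the fraction of the lines $\ell\in\mathcal L_i$ with $x|_\ell\neq 0$. For codes $\mathcal C_i\subseteq\mathbb F^{n_i}$ let $\mathcal C^{(i)}=\{c\in\mathbb F^{X}: c|_\ell\in\mathcal C_i\text{ for all }\ell\in\mathcal L_i\}$, $\mathcal C_1\otimes\dots\otimes\mathcal C_m=\bigcap_i\mathcal C^{(i)}$ and $\mathcal C_1\boxplus\dots\boxplus\mathcal C_m=\sum_i\mathcal C^{(i)}$. $\bullet$ $\rho(\mathcal C_1,\dots,\mathcal C_m)$ is the largest real $\rho$ such that every $c\in\mathcal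 C_1\boxplus\dots\boxplus\mathcal C_m$ can be written as $c=\sum_i a_i$ with $a_i\in\mathcal C^{(i)}$ and $\rho\sum_i\|a_i\|_i\le\|c\|$. $\bullet$ For $k\in[m-1]$ the axis-parallel $k$-flat test is $T_m^k=\bigcup_{|I|=k}\mathcal L_I$. For a family $T$ of subsets of $X$ and a code $D\subseteq\mathbb F^{X}$, $\rho_r(T,D)$ is the largest real $\alpha$ such that $\mathsf E_{J\in T}\,\delta(c|_J,D|_J)\ge\alpha\,\delta(c,D)$ for all $c\in\mathbb F^{X}$, where $D|_J=\{d|_J: d\in D\}$ and $J\in T$ is chosen with probability $|J|/\sum_{J'\in T}|J'|$. $\bullet$ $\rho_a(\mathcal C_1\otimes\dots\otimes\mathcal C_m)$ is the largest real $\alpha$ such that for all $c_1\in\mathcal C^{(1)},\dots,c_m\in\mathcal C^{(m)}$ there is $c\in\mathcal C_1\otimes\dots\otimes\mathcal C_m$ with $\alpha\,\mathsf E_{i\in[m]}\|c_i-c\|_i\le\mathsf E_{i,j\in[m]}\|c_i-c_j\|$, with $i,j$ uniform and independent in $[m]$. \textbf{Theorem.} For an integer $t\ge 1$ put $n_t=2^{2t}-1$,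 let $\omega$ be a primitive element of $\mathbb F_{2^{2t}}$, and let $C_t$ be the primitive Reed--Solomon $[n_t,n_t/3]$ code over $\mathbb F_{2^{2t}}$ with check polynomial $p(x)=(x-1)(x-\omega)\cdots(x-\omega^{n_t/3-1})$, i.e. the set of all $(a_0,\dots,a_{n_t-1})\in\mathbb F_{2^{2t}}^{n_t}$ with $p(x)\sum_i a_ix^i\equiv 0 \bmod (x^{n_t}-1)$. For each $m\ge 3$ there exist $\alpha_r>0$ and $\alpha_a>0$ such that for every integer $t\ge1$ and every choice of the primitive element $\omega$ the maxima $\rho$, $\rho_r$, $\rho_a$ below exist and 1. $\rho(C_t,\dots,C_t)\le \dfrac1{n_t}$, with $m$ copies of $C_t$; 2. $\rho_r(T_m^k,C_t^{\otimes m})\ge\alpha_r$ for all $k\in[m-1]$; 3. $\rho_a(C_t^{\otimes m})\ge\alpha_a$. -/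

import Mathlib

open Polynomial

noncomputable section

/-! ### Words and codes over a finite index set -/

open Classical in
/-- The normalized Hamming weight `‖x‖`: the fraction of non-zero entries of the word `x`. -/
def relWeight {F X : Type*} [Field F] [Fintype X] (x : X → F) : ℝ :=
  (hammingNorm x : ℝ) / (Fintype.card X : ℝ)

/-- The normalized distance `δ(x, D) = min_{y ∈ D} ‖x - y‖` from a word to a (non-empty) code. -/
def relDist {F X : Type*} [Field F] [Fintype X] (x : X → F) (D : Set (X → F)) : ℝ :=
  ⨅ y : D, relWeight (x - (y : X → F))

/-- The restriction `c|_I` of a word to a set `I` of indices. -/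
def restrictWord {F X : Type*} (I : Finset X) (c : X → F) : I → F := fun p => c p

/-- The punctured code `D|_I`. -/
def restrictCode {F X : Type*} (I : Finset X) (D : Set (X → F)) : Set (I → F) :=
  restrictWord I '' D

/-! ### Tests and robustness -/

/-- The expectation of `f` over a test `T`, where `I ∈ T` is chosen with probability
`|I| / ∑_{J ∈ T} |J|`. -/
def testExpectation {X : Type*} (T : Finset (Finset X)) (f : Finset X → ℝ) : ℝ :=
  ∑ I ∈ T, ((I.card : ℝ) / ∑ J ∈ T, (J.card : ℝ)) * f I

/-- The test `T` for the code `D` is `α`-robust. -/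
def IsRobustTest {F X : Type*} [Field F] [Fintype X]
    (T : Finset (Finset X)) (D : Set (X → F)) (α : ℝ) : Prop :=
  ∀ c : X → F,
    α * relDist c D ≤ testExpectation T fun I => relDist (restrictWord I c) (restrictCode I D)

/-- The maximal robustness `ρ_r(T, D)`. -/
def robustness {F X : Type*} [Field F] [Fintype X]
    (T : Finset (Finset X)) (D : Set (X → F)) : ℝ :=
  sSup {α : ℝ | IsRobustTest T D α}

/-! ### Grids, lines and flats -/

/-- The grid `[n₁] × ⋯ × [n_m]`. -/
abbrev Grid {m : ℕ} (n : Fin m → ℕ) : Type := (i : Fin m) → Fin (n i)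

/-- The axis-parallel flat through `x` in the directions `I`. -/
def axisFlat {m : ℕ} {n : Fin m → ℕ} (I : Finset (Fin m)) (x : Grid n) : Finset (Grid n) :=
  {y | ∀ j, j ∉ I → y j = x j}

/-- The set `𝓛_I` of all axis-parallel flats in the directions `I`. -/
def flatsAlong {m : ℕ} (n : Fin m → ℕ) (I : Finset (Fin m)) : Finset (Finset (Grid n)) :=
  Finset.univ.image (axisFlat I)

/-- The axis-parallel `k`-flat test `T_m^k`. -/
def flatTest {m : ℕ} (n : Fin m → ℕ) (k : ℕ) : Finset (Finset (Grid n)) :=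
  (Finset.powersetCard k Finset.univ).biUnion (flatsAlong n)

open Classical in
/-- `‖a‖_i`: the fraction of the lines `ℓ` parallel to the `i`-th axis such that `a|_ℓ ≠ 0`. -/
def lineWeight {F : Type*} [Field F] {m : ℕ} {n : Fin m → ℕ} (i : Fin m) (a : Grid n → F) : ℝ :=
  (((flatsAlong n {i}).filter fun l => restrictWord l a ≠ 0).card : ℝ) /
    ((flatsAlong n {i}).card : ℝ)

/-! ### Product codes, product expansion, agreement testability -/

/-- The code `C^{(i)}`: the words whose restriction to each line parallel to the `i`-th axis is a
codeword of `C i`. -/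
def axisCode {F : Type*} [Field F] {m : ℕ} {n : Fin m → ℕ}
    (C : (i : Fin m) → Submodule F (Fin (n i) → F)) (i : Fin m) : Submodule F (Grid n → F) where
  carrier := {c | ∀ x : Grid n, (fun s : Fin (n i) => c (Function.update x i s)) ∈ C i}
  zero_mem' := fun _ => (C i).zero_mem
  add_mem' := fun ha hb x => (C i).add_mem (ha x) (hb x)
  smul_mem' := fun r _ ha x => (C i).smul_mem r (ha x)

/-- The product code `C₁ ⊗ ⋯ ⊗ C_m`, the intersection of the `C^{(i)}`. -/
def productCode {F : Type*} [Field F] {m : ℕ} {n : Fin m → ℕ}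
    (C : (i : Fin m) → Submodule F (Fin (n i) → F)) : Submodule F (Grid n → F) :=
  ⨅ i, axisCode C i

/-- The code `C₁ ⊞ ⋯ ⊞ C_m = C^{(1)} + ⋯ + C^{(m)}`. -/
def boxSumCode {F : Type*} [Field F] {m : ℕ} {n : Fin m → ℕ}
    (C : (i : Fin m) → Submodule F (Fin (n i) → F)) : Submodule F (Grid n → F) :=
  ⨆ i, axisCode C i

/-- The collection `C` is `ρ`-product-expanding. -/
def IsProductExpanding {F : Type*} [Field F] {m : ℕ} {n : Fin m → ℕ}
    (C : (i : Fin m) → Submodule F (Fin (n i) → F)) (ρ : ℝ) : Prop :=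
  ∀ c ∈ boxSumCode C, ∃ a : Fin m → (Grid n → F),
    (∀ i, a i ∈ axisCode C i) ∧ c = ∑ i, a i ∧ ρ * ∑ i, lineWeight i (a i) ≤ relWeight c

/-- The product expansion `ρ(C₁, …, C_m)`. -/
def productExpansion {F : Type*} [Field F] {m : ℕ} {n : Fin m → ℕ}
    (C : (i : Fin m) → Submodule F (Fin (n i) → F)) : ℝ :=
  sSup {ρ : ℝ | IsProductExpanding C ρ}

/-- The product code `C₁ ⊗ ⋯ ⊗ C_m` is `α`-agreement testable. -/
def IsAgreementTestable {F : Type*} [Field F] {m : ℕ} {n : Fin m → ℕ}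
    (C : (i : Fin m) → Submodule F (Fin (n i) → F)) (α : ℝ) : Prop :=
  ∀ c : Fin m → (Grid n → F), (∀ i, c i ∈ axisCode C i) →
    ∃ z ∈ productCode C,
      α * ((∑ i, lineWeight i (c i - z)) / (m : ℝ)) ≤
        (∑ i, ∑ j, relWeight (c i - c j)) / (m : ℝ) ^ 2

/-- The maximal agreement testability `ρ_a(C₁ ⊗ ⋯ ⊗ C_m)`. -/
def agreementTestability {F : Type*} [Field F] {m : ℕ} {n : Fin m → ℕ}
    (C : (i : Fin m) → Submodule F (Fin (n i) → F)) : ℝ :=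
  sSup {α : ℝ | IsAgreementTestable C α}

/-! ### Cyclic codes and primitive Reed-Solomon codes -/

/-- The cyclic code of length `n` with check polynomial `p`: the words `(a_0, …, a_{n-1})` with
`p(x) ∑ a_i x^i ≡ 0 mod (x^n - 1)`. -/
def cyclicCode {F : Type*} [Field F] (n : ℕ) (p : F[X]) : Submodule F (Fin n → F) where
  carrier := {a | (X ^ n - 1 : F[X]) ∣ p * ∑ i, C (a i) * X ^ (i : ℕ)}
  zero_mem' := by simp
  add_mem' := by
    intro a b ha hb
    have h : p * ∑ i, C ((a + b) i) * X ^ (i : ℕ) =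
        p * ∑ i, C (a i) * X ^ (i : ℕ) + p * ∑ i, C (b i) * X ^ (i : ℕ) := by
      simp [add_mul, Finset.sum_add_distrib, mul_add]
    simp only [Set.mem_ofPred_eq] at ha hb ⊢
    rw [h]
    exact dvd_add ha hb
  smul_mem' := by
    intro r a ha
    have h : p * ∑ i, C ((r • a) i) * X ^ (i : ℕ) =
        C r * (p * ∑ i, C (a i) * X ^ (i : ℕ)) := by
      simp [Finset.mul_sum, mul_left_comm, mul_assoc]
    simp only [Set.mem_ofPred_eq] at ha ⊢
    rw [h]
    exact Dvd.dvd.mul_left ha _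

/-- The Reed-Solomon code of length `n` with check polynomial `(x - 1)(x - ω)⋯(x - ω^{k-1})`. -/
def reedSolomonCode {F : Type*} [Field F] (ω : F) (n k : ℕ) : Submodule F (Fin n → F) :=
  cyclicCode n (∏ i ∈ Finset.range k, (X - C (ω ^ i)))

end

/-! The code `reedSolomonCode ω n d` with n = 3d consists of the evaluations of polynomials of
degree < d at the powers of ω⁻¹ (`mem_reedSolomonCode_iff`), so any d positions form an information
set (`isMDS_reedSolomonCode`).

Product expansion is destroyed by one word. Put χ(i) = ω^(-i). On the points with x_k = 0 for k ≥ 3,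
`surfaceWord` is the sum over e < n of χ(x₀)^e χ(x₁)^(e+d) χ(x₂)^(e+2d). For each e one of the three
exponents lies in [0, d) modulo n, so each summand is in some C^(i). By orthogonality of characters
the sum lives on the surface x₀ + x₁ + x₂ ≡ 0 mod n, which meets every axis-parallel line at most
once. A decomposition therefore needs a line for each support point
(`hammingNorm_le_sum_card_nonzeroLines`), and a line has n points, whence ρ ≤ 1/n.

Robustness and agreement testability both follow from `IsLineTestable`: a word near some word of
each C^(i) is near a codeword, with a constant depending only on m. In dimension 2 this is the
Polishchuk–Spielman theorem (`exists_large_subgrid_of_rows_of_columns`), and rate 1/3 leaves room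
for its degree condition. `IsLineTestable.succ` raises the dimension. Testing all hyperplanes gives,
for each of three directions, a word near f that is a codeword on every hyperplane orthogonal to
that direction. Two such words are compared through the third: where a hyperplane of the first meets
one of the second, both agree with the third word on most of each line in the third direction, so
they coincide there. `IsMDS.exists_mem_tensorPow_of_agree` then glues them into a codeword.

For Q in F[X][Y], `Q.natDegree` is the degree in Y and `(swap Q).natDegree` the degree in X. -/

noncomputable section

/-! ### Bivariate polynomials -/

section Bivariate

open Polynomial.Bivariate

variable {F : Type*} [Field F]

/-- Substitution of a constant for the inner variable of a bivariate polynomial. -/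
def specInner (x : F) : F[X][Y] →ₐ[F] F[X] := mapAlgHom (aeval x)

lemma coeff_specInner (x : F) (Q : F[X][Y]) (k : ℕ) :
    (specInner x Q).coeff k = (Q.coeff k).eval x := by
  simp [specInner, coeff_map]

lemma natDegree_specInner_le (x : F) (Q : F[X][Y]) :
    (specInner x Q).natDegree ≤ Q.natDegree := by
  simpa [specInner] using natDegree_map_le

lemma eval_specInner (x y : F) (Q : F[X][Y]) : (specInner x Q).eval y = Q.evalEval x y := by
  rw [← map_evalRingHom_eval]
  congr 1

lemma evalEval_swap' (x y : F) (Q : F[X][Y]) : (swap Q).evalEval x y = Q.evalEval y x := by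
  rw [← coe_aevalAeval_eq_evalEval, ← coe_aevalAeval_eq_evalEval, aevalAeval_swap]

lemma eval_C_swap (x : F) (Q : F[X][Y]) : (swap Q).eval (C x) = specInner x Q := by
  induction Q using Polynomial.induction_on' with
  | add p q hp hq => simp [hp, hq]
  | monomial n f =>
    rw [swap_monomial, eval_mul, eval_C, eval_map, eval₂_at_apply, C_mul_X_pow_eq_monomial]
    simp [specInner]

/-- The bivariate polynomial with the coefficients `u`. -/
def boxPoly (a b : ℕ) : (Fin a × Fin b → F) →ₗ[F] F[X][Y] where
  toFun u := ∑ p, monomial p.1 (monomial p.2 (u p))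
  map_add' u v := by simp [Finset.sum_add_distrib]
  map_smul' c u := by simp [Finset.smul_sum, smul_monomial]

lemma boxPoly_apply (a b : ℕ) (u : Fin a × Fin b → F) :
    boxPoly a b u = ∑ p : Fin a × Fin b, monomial (p.1 : ℕ) (monomial (p.2 : ℕ) (u p)) := rfl

lemma boxPoly_injective (a b : ℕ) : Function.Injective (boxPoly (F := F) a b) := by
  intro u v h
  ext ⟨i, j⟩
  have key : ∀ w : Fin a × Fin b → F, ((boxPoly a b w).coeff i).coeff j = w (i, j) := by
    intro w
    simp only [boxPoly_apply, finsetSum_coeff, coeff_monomial]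
    rw [Finset.sum_eq_single (i, j)]
    · simp
    · rintro ⟨i', j'⟩ - hne
      by_cases hi : (i' : ℕ) = i
      · have hj : (j' : ℕ) ≠ j := fun hj => hne (by ext <;> simp [hi, hj])
        simp [hi, coeff_monomial, hj]
      · simp [hi]
    · simp
  rw [← key u, h, key]

lemma natDegree_boxPoly_lt {a b : ℕ} (ha : 0 < a) (u : Fin a × Fin b → F) :
    (boxPoly a b u).natDegree < a := by
  rw [Nat.lt_iff_le_pred ha, boxPoly_apply]
  refine natDegree_sum_le_of_forall_le _ _ fun p _ => (natDegree_monomial_le _).trans ?_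
  have := p.1.2
  omega

lemma swap_boxPoly (a b : ℕ) (u : Fin a × Fin b → F) :
    swap (boxPoly a b u) = boxPoly b a (u ∘ Prod.swap) := by
  rw [boxPoly_apply, boxPoly_apply, map_sum, ← (Equiv.prodComm (Fin b) (Fin a)).sum_comp]
  simp [swap_monomial_monomial]

lemma natDegree_swap_boxPoly_lt {a b : ℕ} (hb : 0 < b) (u : Fin a × Fin b → F) :
    (swap (boxPoly a b u)).natDegree < b := by
  rw [swap_boxPoly]; exact natDegree_boxPoly_lt hb _

/-- Viewed as a polynomial in X over the domain F[Y], `W` has more roots, namely the constants x i,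
than its degree allows. -/
lemma eq_zero_of_specInner_eq_zero {ι : Type*} {x : ι → F} {s : Finset ι} (hx : Set.InjOn x s)
    {W : F[X][Y]} (hdeg : (swap W).natDegree < s.card) (h : ∀ i ∈ s, specInner (x i) W = 0) :
    W = 0 := by
  have : swap W = 0 := by
    refine eq_zero_of_degree_lt_of_eval_index_eq_zero (v := fun i => C (x i)) (s := s) ?_
      (degree_le_natDegree.trans_lt (by exact_mod_cast hdeg)) ?_
    · intro i hi j hj hij
      exact hx hi hj (C_injective hij)
    · intro i hi
      rw [eval_C_swap, h i hi]
  simpa using this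

/-- A nonzero bivariate polynomial with small degrees vanishing on a small set. -/
lemma exists_ne_zero_evalEval_eq_zero {ι : Type*} (x : ι → F) (B : Finset (ι × ι)) (a : ℕ)
    (hB : B.card < (a + 1) ^ 2) :
    ∃ E : F[X][Y], E ≠ 0 ∧ E.natDegree ≤ a ∧ (swap E).natDegree ≤ a ∧
      ∀ p ∈ B, E.evalEval (x p.1) (x p.2) = 0 := by
  -- There are (a + 1)² free coefficients and fewer linear conditions.
  let L : (Fin (a + 1) × Fin (a + 1) → F) →ₗ[F] (B → F) :=
    LinearMap.pi fun p => (leval (x p.1.2)) ∘ₗ (specInner (x p.1.1)).toLinearMap ∘ₗ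
      boxPoly (a + 1) (a + 1)
  have hL : LinearMap.ker L ≠ ⊥ := by
    apply LinearMap.ker_ne_bot_of_finrank_lt
    simpa [← sq] using hB
  obtain ⟨u, hu, hu0⟩ := (Submodule.ne_bot_iff _).1 hL
  refine ⟨boxPoly _ _ u, fun h => hu0 (boxPoly_injective _ _ (by simpa using h)),
    Nat.lt_succ_iff.1 (natDegree_boxPoly_lt (by omega) _),
    Nat.lt_succ_iff.1 (natDegree_swap_boxPoly_lt (by omega) _), fun p hp => ?_⟩
  have := congrFun (LinearMap.mem_ker.1 hu) ⟨p, hp⟩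
  simpa [L, eval_specInner, leval] using this

/-- If the specializations of `P` are small multiples of those of a coprime `E` at many points,
then the outer degree of `E` is zero or smaller than the inner one. -/
lemma natDegree_lt_natDegree_swap_of_isRelPrime {ι : Type*} {x : ι → F} {s : Finset ι}
    (hx : Set.InjOn x s) {E P : F[X][Y]} (hE : E ≠ 0) (hEP : IsRelPrime E P) {D : ℕ}
    (hP : (swap P).natDegree ≤ (swap E).natDegree + D)
    (hs : E.natDegree + (swap E).natDegree + 2 * D < s.card) (r : ι → F[X])
    (hr : ∀ i ∈ s, (r i).natDegree ≤ D)
    (hrE : ∀ i ∈ s, specInner (x i) E * r i = specInner (x i) P) (hpos : 0 < E.natDegree) :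
    E.natDegree < (swap E).natDegree := by
  -- If deg_Y E ≥ deg_X E, linear algebra yields a nontrivial relation U E + V P = 0 with deg_Y V <
  -- deg_Y E, which coprimality forbids. The unknowns are U and V, with U + V r i = 0 imposed at
  -- each X = x i.
  by_contra! hle
  set A := E.natDegree with hA
  set b := (swap E).natDegree with hb
  set N := s.card with hN
  let L : ((Fin (A + D) × Fin (N - b) → F) × (Fin A × Fin (N - b - D) → F)) →ₗ[F]
      (s × Fin (A + D) → F) :=
    LinearMap.pi fun p => lcoeff F p.2 ∘ₗ
      ((specInner (x p.1)).toLinearMap ∘ₗ boxPoly _ _ ∘ₗ LinearMap.fst _ _ _ +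
        LinearMap.mulRight F (r p.1) ∘ₗ (specInner (x p.1)).toLinearMap ∘ₗ boxPoly _ _ ∘ₗ
          LinearMap.snd _ _ _)
  have hL : LinearMap.ker L ≠ ⊥ := by
    apply LinearMap.ker_ne_bot_of_finrank_lt
    simp only [Module.finrank_fintype_fun_eq_card, Fintype.card_prod, Fintype.card_coe,
      Fintype.card_fin, Module.finrank_prod, ← hN]
    -- With N = M + b + D, unknowns minus equations equals A M - b (A + D). This is positive because
    -- A ≥ b, A > 0 and M > A + D.
    obtain ⟨M, hM⟩ : ∃ M, N = M + b + D := ⟨N - b - D, by omega⟩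
    have h1 : N - b = M + D := by omega
    have h2 : N - b - D = M := by omega
    rw [h2, h1, hM]
    have h3 : A + D < M := by omega
    nlinarith
  obtain ⟨⟨u, v⟩, huv, hne⟩ := (Submodule.ne_bot_iff _).1 hL
  set U := boxPoly _ _ u with hU
  set V := boxPoly _ _ v with hV
  have hUY : U.natDegree < A + D := natDegree_boxPoly_lt (by omega) _
  have hVY : V.natDegree < A := natDegree_boxPoly_lt (by omega) _
  have hUX : (swap U).natDegree < N - b := natDegree_swap_boxPoly_lt (by omega) _
  have hVX : (swap V).natDegree < N - b - D := natDegree_swap_boxPoly_lt (by omega) _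
  have hker : ∀ i ∈ s, specInner (x i) U + specInner (x i) V * r i = 0 := by
    intro i hi
    ext k
    by_cases hk : k < A + D
    · simpa [L] using congrFun (LinearMap.mem_ker.1 huv) (⟨i, hi⟩, ⟨k, hk⟩)
    · rw [coeff_zero]
      apply coeff_eq_zero_of_natDegree_lt
      refine (natDegree_add_le _ _).trans_lt (max_lt ?_ ?_)
      · exact ((natDegree_specInner_le _ _).trans_lt hUY).trans_le (not_lt.1 hk)
      · refine natDegree_mul_le.trans_lt ?_
        have := natDegree_specInner_le (x i) V
        have := hr i hi
        omega
  -- At X = x i the left side is E (U + V r i) = 0, and its X-degree is below the number of such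
  -- points.
  have hW : U * E + V * P = 0 := by
    refine eq_zero_of_specInner_eq_zero hx ?_ fun i hi => ?_
    · rw [map_add, map_mul, map_mul]
      refine (natDegree_add_le _ _).trans_lt (max_lt ?_ ?_)
      · refine natDegree_mul_le.trans_lt ?_
        omega
      · refine natDegree_mul_le.trans_lt ?_
        omega
    · rw [map_add, map_mul, map_mul, ← hrE i hi]
      linear_combination specInner (x i) E * hker i hi
  have hdvd : E ∣ V := by
    refine hEP.dvd_of_dvd_mul_right ⟨-U, ?_⟩
    linear_combination hW
  have hV0 : V = 0 := by
    by_contra h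
    have := natDegree_le_of_dvd hdvd h
    omega
  have hU0 : U = 0 := by
    rw [hV0, zero_mul, add_zero] at hW
    exact (mul_eq_zero.1 hW).resolve_right hE
  apply hne
  have hu : u = 0 := boxPoly_injective _ _ (by simpa using hU0)
  have hv : v = 0 := boxPoly_injective _ _ (by simpa using hV0)
  rw [hu, hv]; rfl

/-! ### The Polishchuk–Spielman theorem -/

variable {ι : Type*} [Fintype ι]

lemma eq_of_natDegree_lt_of_eval_eq {x : ι → F} (hx : Function.Injective x) {f g : F[X]}
    (hf : f.natDegree < Fintype.card ι) (hg : g.natDegree < Fintype.card ι)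
    (h : ∀ i, f.eval (x i) = g.eval (x i)) : f = g :=
  eq_of_degrees_lt_of_eval_index_eq Finset.univ hx.injOn
    (degree_le_natDegree.trans_lt (by exact_mod_cast hf))
    (degree_le_natDegree.trans_lt (by exact_mod_cast hg)) fun i _ => h i

/-- Words on a grid that are low degree polynomials on all rows and on all columns are low degree
bivariate polynomials. -/
lemma exists_bivariate_of_rows_of_columns {x : ι → F} (hx : Function.Injective x)
    (R Q : ι → F[X]) {a b : ℕ} (ha : a < Fintype.card ι) (hb : b < Fintype.card ι)
    (hR : ∀ j, (R j).natDegree ≤ a) (hQ : ∀ i, (Q i).natDegree ≤ b)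
    (hRQ : ∀ i j, (R j).eval (x i) = (Q i).eval (x j)) :
    ∃ P : F[X][Y], P.natDegree ≤ b ∧ (swap P).natDegree ≤ a ∧
      (∀ i, specInner (x i) P = Q i) ∧ ∀ j, specInner (x j) (swap P) = R j := by
  classical
  -- The interpolant in Y through b + 1 rows, P = ∑ R k (X) ℓ k (Y), restricts to Q i at X = x i
  -- since Q i has degree at most b.
  obtain ⟨T, -, hT⟩ := Finset.exists_subset_card_eq (s := (Finset.univ : Finset ι))
    (show b + 1 ≤ _ from hb)
  have hbasis : ∀ k ∈ T, (Lagrange.basis T x k).natDegree ≤ b := fun k hk =>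
    natDegree_le_of_degree_le (by rw [Lagrange.degree_basis hx.injOn hk, hT]; simp)
  have hP : ∀ i, specInner (x i) (∑ k ∈ T, C (R k) * (Lagrange.basis T x k).map C) = Q i := by
    intro i
    have hd : (Q i).degree < T.card :=
      degree_le_natDegree.trans_lt (by rw [hT]; exact_mod_cast Nat.lt_succ_of_le (hQ i))
    rw [Lagrange.eq_interpolate hx.injOn hd, Lagrange.interpolate_apply, map_sum]
    refine Finset.sum_congr rfl fun k _ => ?_
    rw [map_mul, ← hRQ]
    congr 1
    · simp [specInner]
    · ext l
      simp [coeff_specInner]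
  have hdegX : (swap (∑ k ∈ T, C (R k) * (Lagrange.basis T x k).map C)).natDegree ≤ a := by
    rw [map_sum]
    refine natDegree_sum_le_of_forall_le _ _ fun k hk => ?_
    rw [map_mul, swap_C, swap_map_C]
    refine (natDegree_mul_C_le _ _).trans ?_
    exact natDegree_map_le.trans (hR k)
  refine ⟨∑ k ∈ T, C (R k) * (Lagrange.basis T x k).map C, ?_, hdegX, hP, fun j => ?_⟩
  · refine natDegree_sum_le_of_forall_le _ _ fun k hk => ?_
    exact (natDegree_C_mul_le _ _).trans (natDegree_map_le.trans (hbasis k hk))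
  · refine eq_of_natDegree_lt_of_eval_eq hx ?_ ((hR j).trans_lt ha) fun i => ?_
    · exact ((natDegree_specInner_le _ _).trans hdegX).trans_lt ha
    · rw [eval_specInner, evalEval_swap', ← eval_specInner, hP, hRQ]

lemma card_filter_specInner_eq_zero_le [DecidableEq F[X]] {x : ι → F} (hx : Function.Injective x)
    {E : F[X][Y]} (hE : E ≠ 0) :
    (Finset.univ.filter fun i => specInner (x i) E = 0).card ≤ (swap E).natDegree := by
  by_contra! h
  refine hE (eq_zero_of_specInner_eq_zero hx.injOn h ?_)
  simp

/-- Polishchuk and Spielman: if a word that is a low degree polynomial on each row agrees with a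
word that is a low degree polynomial on each column up to few points, then they agree on a large
subgrid. -/
theorem exists_large_subgrid_of_rows_of_columns [DecidableEq F]
    {x : ι → F} (hx : Function.Injective x)
    (p q : ι → F[X]) {D a : ℕ} (hp : ∀ j, (p j).natDegree ≤ D) (hq : ∀ i, (q i).natDegree ≤ D)
    (hB : (Finset.univ.filter fun s : ι × ι =>
      (p s.2).eval (x s.1) ≠ (q s.1).eval (x s.2)).card < (a + 1) ^ 2)
    (ha : 3 * a + 2 * D < Fintype.card ι) :
    ∃ S T : Finset ι, Fintype.card ι ≤ S.card + a ∧ Fintype.card ι ≤ T.card + a ∧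
      ∀ i ∈ S, ∀ j ∈ T, (p j).eval (x i) = (q i).eval (x j) := by
  classical
  -- `E` is an error locator: it vanishes wherever rows and columns disagree.
  obtain ⟨E, hE, hEY, hEX, hEB⟩ := exists_ne_zero_evalEval_eq_zero x _ a hB
  have hsE : swap E ≠ 0 := by simpa using hE
  -- After multiplication by `E` rows and columns agree on the whole grid, so the products come from
  -- one polynomial `P`. The aim is to show that `E` divides `P` up to a unit.
  obtain ⟨P, hPY, hPX, hPq, hPp⟩ := exists_bivariate_of_rows_of_columns hx
    (fun j => specInner (x j) (swap E) * p j) (fun i => specInner (x i) E * q i)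
    (a := (swap E).natDegree + D) (b := E.natDegree + D) (by omega) (by omega)
    (fun j => natDegree_mul_le.trans (add_le_add (natDegree_specInner_le _ _) (hp j)))
    (fun i => natDegree_mul_le.trans (add_le_add (natDegree_specInner_le _ _) (hq i)))
    (fun i j => by
      rw [eval_mul, eval_mul, eval_specInner, eval_specInner, evalEval_swap']
      by_cases h : (p j).eval (x i) = (q i).eval (x j)
      · rw [h]
      · rw [hEB (i, j) (by simpa using h), zero_mul, zero_mul])
  obtain ⟨E', P', g, hrel, hgE, hgP⟩ := UniqueFactorizationMonoid.exists_reduced_factors E hE P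
  have hg : g ≠ 0 := by rintro rfl; exact hE (by rw [← hgE, zero_mul])
  have hE' : E' ≠ 0 := by rintro rfl; exact hE (by rw [← hgE, mul_zero])
  have hsg : swap g ≠ 0 := by simpa using hg
  have hsE' : swap E' ≠ 0 := by simpa using hE'
  have hEYm : E.natDegree = g.natDegree + E'.natDegree := by rw [← hgE, natDegree_mul hg hE']
  have hEXm : (swap E).natDegree = (swap g).natDegree + (swap E').natDegree := by
    rw [← hgE, map_mul, natDegree_mul hsg hsE']
  have hPY' : P'.natDegree ≤ E'.natDegree + D := by
    by_cases h : P' = 0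
    · simp [h]
    · rw [← hgP, natDegree_mul hg h] at hPY
      omega
  have hPX' : (swap P').natDegree ≤ (swap E').natDegree + D := by
    by_cases h : P' = 0
    · simp [h]
    · rw [← hgP, map_mul, natDegree_mul hsg (by simpa using h)] at hPX
      omega
  have hrel' : IsRelPrime (swap E') (swap P') := by
    intro d hd1 hd2
    have h1 : swap d ∣ E' := by simpa [swap_swap_apply] using map_dvd swap hd1
    have h2 : swap d ∣ P' := by simpa [swap_swap_apply] using map_dvd swap hd2
    simpa [swap_swap_apply] using (hrel h1 h2).map swap
  -- the specializations at which the common factor does not vanish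
  have hcq : ∀ i, specInner (x i) g ≠ 0 →
      specInner (x i) E' * q i = specInner (x i) P' := by
    intro i hi
    have := hPq i
    rw [← hgP, ← hgE, map_mul, map_mul] at this
    refine mul_left_cancel₀ hi ?_
    rw [this, mul_assoc]
  have hcp : ∀ j, specInner (x j) (swap g) ≠ 0 →
      specInner (x j) (swap E') * p j = specInner (x j) (swap P') := by
    intro i hi
    have := hPp i
    rw [← hgP, ← hgE, map_mul, map_mul, map_mul, map_mul] at this
    refine mul_left_cancel₀ hi ?_
    rw [this, mul_assoc]
  have hcount : ∀ G : F[X][Y], G ≠ 0 → Fintype.card ι ≤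
      (Finset.univ.filter fun i => specInner (x i) G ≠ 0).card + (swap G).natDegree := by
    intro G hG
    have h1 := card_filter_specInner_eq_zero_le hx hG
    have h2 := Finset.card_filter_add_card_filter_not (s := (Finset.univ : Finset ι))
      (fun i => specInner (x i) G = 0)
    rw [Finset.card_univ] at h2
    simp only [ne_eq]
    omega
  -- The degree lemma is used for both orders of the variables. The two strict inequalities exclude
  -- each other, so the reduced denominator `E'` is constant.
  have hYzero : 0 < E'.natDegree → E'.natDegree < (swap E').natDegree := by
    refine natDegree_lt_natDegree_swap_of_isRelPrime hx.injOn hE' hrel hPX' (D := D) ?_ q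
      (s := Finset.univ.filter fun i => specInner (x i) g ≠ 0) (fun i _ => hq i)
      (fun i hi => hcq i (by simpa using hi))
    have := hcount g hg
    omega
  have hXzero : 0 < (swap E').natDegree → (swap E').natDegree < E'.natDegree := by
    have := natDegree_lt_natDegree_swap_of_isRelPrime hx.injOn hsE' hrel' (D := D)
      (by simpa [swap_swap_apply] using hPY')
      (s := Finset.univ.filter fun i => specInner (x i) (swap g) ≠ 0) ?_ p
      (fun i _ => hp i) (fun i hi => hcp i (by simpa using hi))
    · simpa [swap_swap_apply] using this
    · have := hcount _ hsg
      rw [swap_swap_apply] at this ⊢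
      omega
  have hY0 : E'.natDegree = 0 := by omega
  have hX0 : (swap E').natDegree = 0 := by omega
  obtain ⟨u, hu, hEu⟩ : ∃ u : F, u ≠ 0 ∧ E' = C (C u) := by
    obtain ⟨f, hf⟩ := natDegree_eq_zero.1 hY0
    rw [← hf, swap_C, natDegree_map_eq_of_injective C_injective] at hX0
    obtain ⟨u, hu⟩ := natDegree_eq_zero.1 hX0
    refine ⟨u, ?_, by rw [← hf, ← hu]⟩
    rintro rfl
    exact hE' (by rw [← hf, ← hu]; simp)
  -- Off the lines on which `g` vanishes identically, at most a in each direction, u p j and u q i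
  -- are both restrictions of `P'`.
  refine ⟨Finset.univ.filter fun i => specInner (x i) g ≠ 0,
    Finset.univ.filter fun j => specInner (x j) (swap g) ≠ 0, ?_, ?_, fun i hi j hj => ?_⟩
  · have := hcount g hg
    omega
  · have := hcount _ hsg
    rw [swap_swap_apply] at this
    omega
  · have h1 := congrArg (eval (x j)) (hcq i (by simpa using hi))
    have h2 := congrArg (eval (x i)) (hcp j (by simpa using hj))
    rw [eval_mul, eval_specInner, eval_specInner, hEu, evalEval_C, eval_C] at h1
    rw [eval_mul, eval_specInner, eval_specInner, evalEval_swap', evalEval_swap', hEu, evalEval_C,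
      eval_C, ← h1] at h2
    exact mul_left_cancel₀ hu h2

end Bivariate

/-! ### Codes on cubical grids -/

section Grid

variable {F : Type*} [Field F] {n m d : ℕ} {C : Submodule F (Fin n → F)}

/-- The code of all words in `m` dimensions whose lines in direction `i` are in `C`. -/
abbrev axisPow (C : Submodule F (Fin n → F)) (m : ℕ) (i : Fin m) :
    Submodule F ((Fin m → Fin n) → F) :=
  axisCode (n := fun _ : Fin m => n) (fun _ => C) i

/-- The `m`-th tensor power of `C`. -/
abbrev tensorPow (C : Submodule F (Fin n → F)) (m : ℕ) : Submodule F ((Fin m → Fin n) → F) :=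
  productCode (n := fun _ : Fin m => n) (fun _ => C)

lemma mem_tensorPow {c : (Fin m → Fin n) → F} :
    c ∈ tensorPow C m ↔ ∀ i, c ∈ axisPow C m i := by
  simp [tensorPow, productCode, Submodule.mem_iInf]

/-- A maximum distance separable code of dimension `d`: every set of `d` positions is an
information set. -/
structure IsMDS (C : Submodule F (Fin n → F)) (d : ℕ) : Prop where
  eq_zero : ∀ c ∈ C, ∀ S : Finset (Fin n), d ≤ S.card → (∀ i ∈ S, c i = 0) → c = 0
  exists_interpolation : ∀ S : Finset (Fin n), S.card = d → ∀ g : Fin n → F,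
    ∃ c ∈ C, ∀ i ∈ S, c i = g i

/-- Words that agree on many points of each line in a given direction are equal on these lines. -/
lemma IsMDS.eq_of_agree_on_line (hC : IsMDS C d) {i : Fin m} {g h : (Fin m → Fin n) → F}
    (hg : g ∈ axisPow C m i) (hh : h ∈ axisPow C m i) (x : Fin m → Fin n) (S : Finset (Fin n))
    (hS : d ≤ S.card) (hgh : ∀ s ∈ S, g (Function.update x i s) = h (Function.update x i s)) :
    g x = h x := by
  have := hC.eq_zero _ (C.sub_mem (hg x) (hh x)) S hS (fun s hs => by
    simpa [sub_eq_zero] using hgh s hs)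
  simpa [sub_eq_zero] using congrFun this (x i)

/-- Two words consistent on many hyperplanes in two directions come from a codeword. -/
lemma IsMDS.exists_mem_tensorPow_of_agree (hC : IsMDS C d) {i j : Fin m} (hij : i ≠ j)
    {g h : (Fin m → Fin n) → F} (hg : ∀ k ≠ i, g ∈ axisPow C m k)
    (hh : ∀ k ≠ j, h ∈ axisPow C m k) {S T : Finset (Fin n)} (hS : d ≤ S.card) (hT : d ≤ T.card)
    (hgh : ∀ x, x i ∈ S → x j ∈ T → g x = h x) :
    ∃ z ∈ tensorPow C m, (∀ x, x i ∈ S → z x = g x) ∧ ∀ x, x j ∈ T → z x = h x := by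
  classical
  obtain ⟨D, hDS, hD⟩ := Finset.exists_subset_card_eq hS
  choose L hLC hL using fun k : Fin n => hC.exists_interpolation D hD (Pi.single k 1)
  -- `L k` is the codeword that is 1 at k and 0 on the rest of `D`, so `z` interpolates `g` in
  -- direction i from the d hyperplanes x i ∈ D.
  let z : (Fin m → Fin n) → F := fun x => ∑ k ∈ D, L k (x i) * g (Function.update x i k)
  have hzi : z ∈ axisPow C m i := by
    intro x
    have : (fun s => z (Function.update x i s)) =
        ∑ k ∈ D, g (Function.update x i k) • L k := by
      ext s
      simp [z, mul_comm]
    rw [this]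
    exact C.sum_mem fun k _ => C.smul_mem _ (hLC k)
  have hz : z ∈ tensorPow C m := by
    refine mem_tensorPow.2 fun j => ?_
    by_cases hji : j = i
    · exact hji ▸ hzi
    intro x
    have : (fun s => z (Function.update x j s)) =
        ∑ k ∈ D, L k (x i) • fun s => g (Function.update (Function.update x i k) j s) := by
      ext s
      simp [z, Function.update_of_ne (Ne.symm hji), Function.update_comm hji]
    rw [this]
    exact C.sum_mem fun k _ => C.smul_mem _ (hg j hji _)
  -- Along direction i, `z` and `h` are both in `C` and agree with `g` at the d positions of `D`.
  have hzT : ∀ x, x j ∈ T → z x = h x := by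
    intro x hx
    refine hC.eq_of_agree_on_line hzi (hh i hij) x D hD.ge fun s hs => ?_
    rw [← hgh _ (by simpa using hDS hs) (by simpa [hij.symm] using hx)]
    simp only [z, Function.update_self, Function.update_idem]
    rw [Finset.sum_eq_single s]
    · simp [hL s s hs]
    · intro k _ hks
      simp [hL k s hs, hks.symm]
    · exact fun h => absurd hs h
  -- Now along direction j: `z` and `g` are both in `C`, and both equal `h` at the positions of `T`.
  refine ⟨z, hz, fun x hx => ?_, hzT⟩
  refine hC.eq_of_agree_on_line (mem_tensorPow.1 hz j) (hg j hij.symm) x T hT fun t ht => ?_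
  rw [hzT _ (by simpa using ht), hgh _ (by simpa [hij] using hx) (by simpa using ht)]

/-- The minimum distance of tensor powers. -/
lemma IsMDS.pow_le_card_of_ne_zero [DecidableEq F] (hC : IsMDS C d) (hd : 2 * d ≤ n)
    {h : (Fin m → Fin n) → F} (J : Finset (Fin m)) (hh : ∀ k ∈ J, h ∈ axisPow C m k)
    (x : Fin m → Fin n) (hx : h x ≠ 0) :
    n ^ J.card ≤ 2 ^ J.card *
      (Finset.univ.filter fun y : Fin m → Fin n => (∀ k ∉ J, y k = x k) ∧ h y ≠ 0).card := by
  classical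
  induction J using Finset.induction_on generalizing x with
  | empty =>
    simp only [Finset.card_empty, pow_zero, one_mul]
    exact Finset.card_pos.2 ⟨x, by simpa using hx⟩
  | insert k J hk ih =>
    set A : Finset (Fin n) := Finset.univ.filter fun s => h (Function.update x k s) ≠ 0 with hA
    -- Otherwise the line would contain at least n/2 ≥ d zeros.
    have hAcard : n ≤ 2 * A.card := by
      by_contra! hlt
      have hcompl := Finset.card_compl A
      rw [Fintype.card_fin] at hcompl
      refine hx (hC.eq_of_agree_on_line (hh k (Finset.mem_insert_self _ _))
        (Submodule.zero_mem _) x Aᶜ (by omega) fun s hs => ?_)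
      simpa [hA] using hs
    have hstep : ∀ s ∈ A, n ^ J.card ≤ 2 ^ J.card * (Finset.univ.filter fun y : Fin m → Fin n =>
        (∀ l ∉ J, y l = Function.update x k s l) ∧ h y ≠ 0).card := fun s hs =>
      ih (fun l hl => hh l (Finset.mem_insert_of_mem hl)) _ (by simpa [hA] using hs)
    have hunion : ∑ s ∈ A, (Finset.univ.filter fun y : Fin m → Fin n =>
        (∀ l ∉ J, y l = Function.update x k s l) ∧ h y ≠ 0).card ≤
        (Finset.univ.filter fun y : Fin m → Fin n =>
          (∀ l ∉ insert k J, y l = x l) ∧ h y ≠ 0).card := by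
      rw [← Finset.card_biUnion]
      · refine Finset.card_le_card fun y hy => ?_
        obtain ⟨s, -, hy⟩ := Finset.mem_biUnion.1 hy
        simp only [Finset.mem_filter, Finset.mem_univ, true_and] at hy ⊢
        refine ⟨fun l hl => ?_, hy.2⟩
        rw [Finset.mem_insert, not_or] at hl
        rw [hy.1 l hl.2, Function.update_of_ne hl.1]
      · intro s _ t _ hst
        refine Finset.disjoint_left.2 fun y hy hy' => hst ?_
        simp only [Finset.mem_filter, Finset.mem_univ, true_and] at hy hy'
        have h1 := hy.1 k hk
        have h2 := hy'.1 k hk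
        rw [Function.update_self] at h1 h2
        rw [← h1, h2]
    rw [Finset.card_insert_of_notMem hk, pow_succ, pow_succ]
    calc n ^ J.card * n ≤ n ^ J.card * (2 * A.card) := Nat.mul_le_mul_left _ hAcard
      _ = 2 * ∑ s ∈ A, n ^ J.card := by rw [Finset.sum_const, smul_eq_mul]; ring
      _ ≤ 2 * ∑ s ∈ A, 2 ^ J.card * (Finset.univ.filter fun y : Fin m → Fin n =>
        (∀ l ∉ J, y l = Function.update x k s l) ∧ h y ≠ 0).card :=
          Nat.mul_le_mul_left _ (Finset.sum_le_sum hstep)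
      _ ≤ _ := by
        rw [← Finset.mul_sum, ← mul_assoc, mul_comm 2]
        exact Nat.mul_le_mul_left _ hunion

/-! ### The line test and its induction on the dimension -/

lemma hammingDist_eq_sum_slices {A : Type*} [DecidableEq A] (i : Fin (m + 1))
    (f g : (Fin (m + 1) → Fin n) → A) :
    hammingDist f g =
      ∑ s, hammingDist (fun y => f (i.insertNth s y)) (fun y => g (i.insertNth s y)) := by
  simp only [hammingDist, Finset.card_filter]
  rw [← (Fin.insertNthEquiv (fun _ => Fin n) i).sum_comp, Fintype.sum_prod_type]
  rfl

lemma hammingDist_le_pow {A : Type*} [DecidableEq A] (f g : (Fin m → Fin n) → A) :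
    hammingDist f g ≤ n ^ m := by
  simpa using hammingDist_le_card_fintype (x := f) (y := g)

/-- The line test for the `m`-th tensor power of `C` is robust, with unnormalized constant `K`. -/
def IsLineTestable [DecidableEq F] (C : Submodule F (Fin n → F)) (m K : ℕ) : Prop :=
  ∀ (f : (Fin m → Fin n) → F) (c : Fin m → (Fin m → Fin n) → F), (∀ i, c i ∈ axisPow C m i) →
    ∃ z ∈ tensorPow C m, hammingDist f z ≤ K * ∑ i, hammingDist f (c i)

/-- Testing all hyperplanes orthogonal to a direction. -/
lemma IsLineTestable.exists_slicewise [DecidableEq F] {K : ℕ} (hK : IsLineTestable C m K)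
    (f : (Fin (m + 1) → Fin n) → F) (c : Fin (m + 1) → (Fin (m + 1) → Fin n) → F)
    (hc : ∀ i, c i ∈ axisPow C (m + 1) i) (i : Fin (m + 1)) :
    ∃ g, (∀ k ≠ i, g ∈ axisPow C (m + 1) k) ∧
      hammingDist f g ≤ K * ∑ j, hammingDist f (c j) := by
  have hslice : ∀ (s : Fin n) (k : Fin m),
      (fun y => c (i.succAbove k) (i.insertNth s y)) ∈ axisPow C m k := by
    intro s k y
    simp only [Fin.insertNth_update]
    exact hc _ _
  choose z hz hzf using fun s : Fin n => hK (fun y => f (i.insertNth s y)) _ (hslice s)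
  refine ⟨fun x => z (x i) (i.removeNth x), fun k hk x => ?_, ?_⟩
  · obtain ⟨k, rfl⟩ := Fin.exists_succAbove_eq hk
    simp only [Fin.removeNth_update_succAbove, Function.update_of_ne hk.symm]
    exact mem_tensorPow.1 (hz (x i)) k _
  · rw [hammingDist_eq_sum_slices i]
    simp only [Fin.insertNth_apply_same, Fin.removeNth_insertNth]
    calc _ ≤ ∑ s, K * ∑ k, hammingDist (fun y => f (i.insertNth s y))
          (fun y => c (i.succAbove k) (i.insertNth s y)) := Finset.sum_le_sum fun s _ => hzf s
      _ = K * ∑ k, hammingDist f (c (i.succAbove k)) := by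
        rw [← Finset.mul_sum, Finset.sum_comm]
        simp only [← hammingDist_eq_sum_slices]
      _ ≤ _ := by
        rw [Fin.sum_univ_succAbove _ i]
        exact Nat.mul_le_mul_left _ (Nat.le_add_left _ _)

/-- Two words are inconsistent on few of the flats of codimension two orthogonal to two given
directions. -/
lemma IsMDS.card_inconsistent_le [DecidableEq F] (hC : IsMDS C d) (hd : 2 * d ≤ n)
    {i l : Fin m} (hil : i ≠ l) {g h : (Fin m → Fin n) → F}
    (hg : ∀ k ≠ i, g ∈ axisPow C m k) (hh : ∀ k ≠ l, h ∈ axisPow C m k) (P : Finset (Fin n × Fin n))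
    (hP : ∀ p ∈ P, ∃ x : Fin m → Fin n, x i = p.1 ∧ x l = p.2 ∧ g x ≠ h x) :
    P.card * n ^ (m - 2) ≤ 2 ^ (m - 2) * hammingDist g h := by
  classical
  set J : Finset (Fin m) := {i, l}ᶜ with hJ
  have hJcard : J.card = m - 2 := by
    rw [hJ, Finset.card_compl, Fintype.card_fin, Finset.card_pair hil]
  -- On the flat x i = p.1, x l = p.2 the difference g - h is a nonzero tensor codeword in the other
  -- m - 2 directions, hence nonzero on at least a fraction 2^(-(m-2)) of it.
  have hflat : ∀ p ∈ P, n ^ (m - 2) ≤ 2 ^ (m - 2) *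
      (Finset.univ.filter fun y : Fin m → Fin n => (y i = p.1 ∧ y l = p.2) ∧ g y ≠ h y).card := by
    intro p hp
    obtain ⟨x, hxi, hxl, hx⟩ := hP p hp
    have := hC.pow_le_card_of_ne_zero hd (h := g - h) J (fun k hk => by
      simp only [hJ, Finset.mem_compl, Finset.mem_insert, Finset.mem_singleton, not_or] at hk
      exact Submodule.sub_mem _ (hg k hk.1) (hh k hk.2)) x (by simpa [sub_eq_zero] using hx)
    rw [hJcard] at this
    refine this.trans (Nat.mul_le_mul_left _ (Finset.card_le_card fun y hy => ?_))
    simp only [hJ, Finset.mem_filter, Finset.mem_univ, true_and, Finset.mem_compl,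
      Finset.mem_insert, Finset.mem_singleton, not_not, Pi.sub_apply, ne_eq, sub_eq_zero] at hy ⊢
    exact ⟨⟨(hy.1 i (Or.inl rfl)).trans hxi, (hy.1 l (Or.inr rfl)).trans hxl⟩, hy.2⟩
  calc P.card * n ^ (m - 2) = ∑ p ∈ P, n ^ (m - 2) := by rw [Finset.sum_const, smul_eq_mul]
    _ ≤ ∑ p ∈ P, 2 ^ (m - 2) * (Finset.univ.filter fun y : Fin m → Fin n =>
      (y i = p.1 ∧ y l = p.2) ∧ g y ≠ h y).card := Finset.sum_le_sum hflat
    _ ≤ _ := by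
      rw [← Finset.mul_sum]
      refine Nat.mul_le_mul_left _ ?_
      rw [← Finset.card_biUnion]
      · refine Finset.card_le_card fun y hy => ?_
        obtain ⟨p, -, hy⟩ := Finset.mem_biUnion.1 hy
        simp only [Finset.mem_filter, Finset.mem_univ, true_and] at hy ⊢
        exact hy.2
      · intro p _ p' _ hpp
        refine Finset.disjoint_left.2 fun y hy hy' => hpp ?_
        simp only [Finset.mem_filter, Finset.mem_univ, true_and] at hy hy'
        exact Prod.ext (hy.1.1.symm.trans hy'.1.1) (hy.1.2.symm.trans hy'.1.2)

/-- Most hyperplanes orthogonal to a direction are consistent with most of the hyperplanes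
orthogonal to another one. -/
lemma IsMDS.exists_consistent_slices [DecidableEq F] (hC : IsMDS C d) (hd : 2 * d ≤ n)
    {i l : Fin (m + 2)} (hil : i ≠ l) {g h : (Fin (m + 2) → Fin n) → F}
    (hg : ∀ k ≠ i, g ∈ axisPow C (m + 2) k) (hh : ∀ k ≠ l, h ∈ axisPow C (m + 2) k) :
    ∃ S : Finset (Fin n), Sᶜ.card * n ^ (m + 1) ≤ 2 ^ (m + 2) * hammingDist g h ∧
      ∀ s ∈ S, ∃ B : Finset (Fin n), 4 * B.card < n ∧
        ∀ x, x i = s → x l ∉ B → g x = h x := by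
  classical
  let B : Fin n → Finset (Fin n) := fun s => Finset.univ.filter fun u =>
    ∃ x : Fin (m + 2) → Fin n, x i = s ∧ x l = u ∧ g x ≠ h x
  -- The threshold n/4 makes the union of two exceptional sets smaller than n/2, leaving at least d
  -- positions.
  let S : Finset (Fin n) := Finset.univ.filter fun s => 4 * (B s).card < n
  refine ⟨S, ?_, fun s hs => ⟨B s, by simpa [S] using hs, fun x hx hxl => ?_⟩⟩
  · have h1 := hC.card_inconsistent_le hd hil hg hh
      ((Sᶜ.sigma B).map (Equiv.sigmaEquivProd _ _).toEmbedding) (by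
        intro p hp
        obtain ⟨q, hq, rfl⟩ := Finset.mem_map.1 hp
        simpa [B] using (Finset.mem_sigma.1 hq).2)
    rw [Finset.card_map, Finset.card_sigma, Nat.add_sub_cancel] at h1
    have h2 : Sᶜ.card * n ≤ 4 * ∑ s ∈ Sᶜ, (B s).card := by
      rw [Finset.mul_sum, ← smul_eq_mul, ← Finset.sum_const]
      exact Finset.sum_le_sum fun s hs => by simpa [S] using hs
    calc Sᶜ.card * n ^ (m + 1) = Sᶜ.card * n * n ^ m := by ring
      _ ≤ 4 * (∑ s ∈ Sᶜ, (B s).card) * n ^ m := Nat.mul_le_mul_right _ h2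
      _ = 4 * ((∑ s ∈ Sᶜ, (B s).card) * n ^ m) := by ring
      _ ≤ 4 * (2 ^ m * hammingDist g h) := Nat.mul_le_mul_left _ h1
      _ = _ := by ring
  · by_contra hne
    exact hxl (by simpa [B] using ⟨x, hx, rfl, hne⟩)

/-- Words that are consistent on the hyperplanes orthogonal to three directions are close to
a codeword. -/
lemma IsMDS.exists_mem_tensorPow_near [DecidableEq F] (hC : IsMDS C d) (hd : 2 * d ≤ n)
    {i j l : Fin (m + 2)} (hij : i ≠ j) (hil : i ≠ l) (hjl : j ≠ l)
    {g h f : (Fin (m + 2) → Fin n) → F}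
    (hg : ∀ k ≠ i, g ∈ axisPow C (m + 2) k) (hh : ∀ k ≠ j, h ∈ axisPow C (m + 2) k)
    (hf : ∀ k ≠ l, f ∈ axisPow C (m + 2) k) :
    ∃ z ∈ tensorPow C (m + 2),
      hammingDist g z ≤ 2 ^ (m + 3) * (hammingDist g f + hammingDist h f) := by
  classical
  obtain ⟨S, hS, hSB⟩ := hC.exists_consistent_slices hd hil hg hf
  obtain ⟨T, hT, hTB⟩ := hC.exists_consistent_slices hd hjl hh hf
  -- If fewer than d hyperplanes are good, at least half are bad. The bound then exceeds the size of
  -- the grid, and the zero codeword serves.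
  have hlarge : ∀ (U : Finset (Fin n)) (e : ℕ), Uᶜ.card * n ^ (m + 1) ≤ 2 ^ (m + 2) * e →
      U.card < d → n ^ (m + 2) ≤ 2 ^ (m + 3) * e := by
    intro U e hU hUd
    have := Finset.card_compl U
    rw [Fintype.card_fin] at this
    have h1 : n ≤ 2 * Uᶜ.card := by omega
    calc n ^ (m + 2) = n * n ^ (m + 1) := by ring
      _ ≤ 2 * Uᶜ.card * n ^ (m + 1) := Nat.mul_le_mul_right _ h1
      _ = 2 * (Uᶜ.card * n ^ (m + 1)) := by ring
      _ ≤ 2 * (2 ^ (m + 2) * e) := Nat.mul_le_mul_left _ hU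
      _ = _ := by ring
  by_cases hSd : S.card < d
  · refine ⟨0, Submodule.zero_mem _, (hammingDist_le_pow _ _).trans ((hlarge S _ hS hSd).trans ?_)⟩
    exact Nat.mul_le_mul_left _ (Nat.le_add_right _ _)
  by_cases hTd : T.card < d
  · refine ⟨0, Submodule.zero_mem _, (hammingDist_le_pow _ _).trans ((hlarge T _ hT hTd).trans ?_)⟩
    exact Nat.mul_le_mul_left _ (Nat.le_add_left _ _)
  -- For x i ∈ S and x j ∈ T, the line through x in direction l has at least d points where both `g`
  -- and `h` equal `f`; hence g x = h x.
  obtain ⟨z, hz, hzS, -⟩ := hC.exists_mem_tensorPow_of_agree hij hg hh (not_lt.1 hSd)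
    (not_lt.1 hTd) (fun x hxS hxT => by
      obtain ⟨B, hB, hgB⟩ := hSB _ hxS
      obtain ⟨B', hB', hhB⟩ := hTB _ hxT
      have hcard : d ≤ (B ∪ B')ᶜ.card := by
        have h1 := Finset.card_compl (B ∪ B')
        have h2 := Finset.card_union_le B B'
        rw [Fintype.card_fin] at h1
        omega
      refine hC.eq_of_agree_on_line (hg l hil.symm) (hh l hjl.symm) x _ hcard fun s hs => ?_
      simp only [Finset.mem_compl, Finset.mem_union, not_or] at hs
      rw [hgB _ (by simp [hil]) (by simpa using hs.1), hhB _ (by simp [hjl]) (by simpa using hs.2)])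
  refine ⟨z, hz, ?_⟩
  calc hammingDist g z ≤ Sᶜ.card * n ^ (m + 1) := by
        rw [hammingDist_eq_sum_slices i, ← Finset.sum_add_sum_compl S, Finset.sum_eq_zero, zero_add,
          ← smul_eq_mul, ← Finset.sum_const]
        · exact Finset.sum_le_sum fun s _ => hammingDist_le_pow _ _
        · intro s hs
          rw [hammingDist_eq_zero]
          ext y
          exact (hzS _ (by simpa using hs)).symm
    _ ≤ 2 ^ (m + 2) * hammingDist g f := hS
    _ ≤ _ := Nat.mul_le_mul (Nat.pow_le_pow_right (by norm_num) (by omega)) (Nat.le_add_right _ _)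

/-- The line test in one more dimension. -/
lemma IsLineTestable.succ [DecidableEq F] (hC : IsMDS C d) (hd : 2 * d ≤ n) {K : ℕ}
    (hK : IsLineTestable C (m + 2) K) :
    IsLineTestable C (m + 3) (K + 2 ^ (m + 4) * (4 * K)) := by
  intro f c hc
  obtain ⟨E, hE⟩ : ∃ E, E = ∑ j, hammingDist f (c j) := ⟨_, rfl⟩
  have hslice := hK.exists_slicewise f c hc
  simp only [← hE] at hslice ⊢
  obtain ⟨g, hg, hfg⟩ := hslice ⟨0, by omega⟩
  obtain ⟨h, hh, hfh⟩ := hslice ⟨1, by omega⟩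
  obtain ⟨e, he, hfe⟩ := hslice ⟨2, by omega⟩
  obtain ⟨z, hz, hgz⟩ := hC.exists_mem_tensorPow_near hd (by simp) (by simp) (by simp) hg hh he
  refine ⟨z, hz, ?_⟩
  have h1 := hammingDist_triangle_left g e f
  have h2 := hammingDist_triangle_left h e f
  have h3 : hammingDist g e + hammingDist h e ≤ 4 * (K * E) := by omega
  -- The words `g`, `h`, `e` are within K E of f, so the two distances to `e` add up to at most 4 K
  -- E. The power of 2 comes from gluing in dimension m + 3.
  calc hammingDist f z ≤ hammingDist f g + hammingDist g z := hammingDist_triangle _ _ _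
    _ ≤ K * E + 2 ^ (m + 4) * (4 * (K * E)) :=
      add_le_add hfg (hgz.trans (Nat.mul_le_mul_left _ h3))
    _ = _ := by ring

/-- The constant for the line test in `m + 2` dimensions. -/
def lineTestConst : ℕ → ℕ
  | 0 => 300
  | m + 1 => lineTestConst m + 2 ^ (m + 4) * (4 * lineTestConst m)

lemma IsLineTestable.of_two [DecidableEq F] (hC : IsMDS C d) (hd : 2 * d ≤ n)
    (h2 : IsLineTestable C 2 (lineTestConst 0)) (m : ℕ) :
    IsLineTestable C (m + 2) (lineTestConst m) := by
  induction m with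
  | zero => exact h2
  | succ m ih => exact ih.succ hC hd

/-- The line test in two dimensions for evaluation codes. -/
lemma isLineTestable_two [DecidableEq F] (hC : IsMDS C d) (hd : 3 * d ≤ n) (hd0 : 0 < d)
    {x : Fin n → F} (hx : Function.Injective x)
    (hCx : ∀ c ∈ C, ∃ p : F[X], p.natDegree < d ∧ ∀ i, c i = p.eval (x i)) :
    IsLineTestable C 2 (lineTestConst 0) := by
  intro f c hc
  have key : ∃ z ∈ tensorPow C 2, hammingDist (c 1) z ≤ 100 * hammingDist (c 0) (c 1) := by
    -- A disagreement on at least 1/100 of the grid is trivial. Otherwise a < n/10, and with 3 d ≤ n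
    -- this gives 3 a + 2 (d - 1) < n.
    by_cases hlarge : n ^ 2 ≤ 100 * hammingDist (c 0) (c 1)
    · exact ⟨0, Submodule.zero_mem _, (hammingDist_le_pow _ _).trans hlarge⟩
    choose p hp hpc using fun j : Fin n => hCx _ (hc 0 ![j, j])
    choose q hq hqc using fun i : Fin n => hCx _ (hc 1 ![i, i])
    have hp' : ∀ i j, c 0 ![i, j] = (p j).eval (x i) := fun i j => by
      rw [← hpc]; congr 1; ext k; fin_cases k <;> simp
    have hq' : ∀ i j, c 1 ![i, j] = (q i).eval (x j) := fun i j => by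
      rw [← hqc]; congr 1; ext k; fin_cases k <;> simp
    have hcard : (Finset.univ.filter fun s : Fin n × Fin n =>
        (p s.2).eval (x s.1) ≠ (q s.1).eval (x s.2)).card = hammingDist (c 0) (c 1) := by
      rw [hammingDist, ← Finset.card_map (finTwoArrowEquiv (Fin n)).toEmbedding]
      congr 1
      ext ⟨i, j⟩
      simp only [Finset.mem_filter, Finset.mem_univ, true_and, Finset.mem_map_equiv]
      rw [← hp', ← hq']
      rfl
    set a := Nat.sqrt (hammingDist (c 0) (c 1)) with ha
    have ha2 : 10 * a < n := by
      have h1 := Nat.sqrt_le' (hammingDist (c 0) (c 1))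
      rw [← ha] at h1
      by_contra! h
      have := Nat.pow_le_pow_left h 2
      rw [mul_pow] at this
      omega
    obtain ⟨S, T, hS, hT, hST⟩ := exists_large_subgrid_of_rows_of_columns hx p q (D := d - 1)
      (a := a) (fun j => by have := hp j; omega) (fun j => by have := hq j; omega)
      (by rw [hcard]; exact Nat.lt_succ_sqrt' _) (by rw [Fintype.card_fin]; omega)
    rw [Fintype.card_fin] at hS hT
    have hgrid : ∀ y : Fin 2 → Fin n, y = ![y 0, y 1] := fun y => by
      ext k; fin_cases k <;> rfl
    obtain ⟨z, hz, -, hzT⟩ := hC.exists_mem_tensorPow_of_agree (i := (0 : Fin 2)) (j := 1)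
      (by decide) (g := c 1) (h := c 0) (S := S) (T := T)
      (fun k hk => by
        obtain rfl : k = 1 := by omega
        exact hc 1)
      (fun k hk => by
        obtain rfl : k = 0 := by omega
        exact hc 0) (by omega) (by omega)
      (fun y hyS hyT => by
        rw [hgrid y, hp', hq', hST _ hyS _ hyT])
    refine ⟨z, hz, ?_⟩
    -- This is proved slice by slice. If `c 0` and `c 1` differ in fewer than n/2 places of a slice,
    -- then removing these places from `T` leaves at least d positions where z = c 0 = c 1, so `z`
    -- and `c 1` coincide on the slice.
    suffices h : hammingDist (c 1) z ≤ 2 * hammingDist (c 0) (c 1) by omega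
    rw [hammingDist_eq_sum_slices 0, hammingDist_eq_sum_slices 0 (c 0), Finset.mul_sum]
    refine Finset.sum_le_sum fun s _ => ?_
    by_contra! hlt
    have hn : hammingDist (fun y => c 1 (Fin.insertNth 0 s y)) (fun y => z (Fin.insertNth 0 s y)) ≤
        n := (hammingDist_le_pow (n := n) (m := 1) _ _).trans_eq (pow_one n)
    have hpos := (Nat.zero_le _).trans_lt hlt
    rw [hammingDist_pos] at hpos
    refine hpos (funext fun y => ?_)
    let A : Finset (Fin n) := Finset.univ.filter fun t => c 0 ![s, t] ≠ c 1 ![s, t]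
    have hA : A.card = hammingDist (fun y => c 0 (Fin.insertNth 0 s y))
        (fun y => c 1 (Fin.insertNth 0 s y)) := by
      rw [hammingDist, ← Finset.card_map (Equiv.funUnique (Fin 1) (Fin n)).toEmbedding]
      congr 1
      ext t
      simp only [A, Finset.mem_filter, Finset.mem_univ, true_and, Finset.mem_map_equiv]
      rw [hgrid (Fin.insertNth 0 s _)]
      rfl
    have hTA : d ≤ (T \ A).card := by
      have := Finset.le_card_sdiff A T
      omega
    refine hC.eq_of_agree_on_line (hc 1) (mem_tensorPow.1 hz 1) _ _ hTA fun t ht => ?_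
    obtain ⟨htT, htA⟩ := Finset.mem_sdiff.1 ht
    rw [hzT _ (by simpa using htT)]
    simp only [A, Finset.mem_filter, Finset.mem_univ, true_and, not_not] at htA
    rw [hgrid (Function.update _ _ _)]
    simpa using htA.symm
  obtain ⟨z, hz, hzc⟩ := key
  refine ⟨z, hz, ?_⟩
  have h1 := hammingDist_triangle f (c 1) z
  have h2 := hammingDist_triangle_left (c 0) (c 1) f
  -- The triangle inequality already gives the factor 101; 300 is generous.
  rw [Fin.sum_univ_two]
  simp only [lineTestConst]
  omega

end Grid

/-! ### Reed-Solomon codes -/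

section ReedSolomon

variable {F : Type*} [Field F] {n d : ℕ} {ω : F}

lemma sum_pow_eq_zero_of_pow_eq_one {ζ : F} (h : ζ ^ n = 1) (hζ : ζ ≠ 1) :
    ∑ j ∈ Finset.range n, ζ ^ j = 0 := by
  have := mul_geom_sum ζ n
  rw [h, sub_self] at this
  exact (mul_eq_zero.1 this).resolve_left (sub_ne_zero.2 hζ)

/-- The generating polynomial of the word is the geometric sum (X^n - 1)/(ω^(-j) X - 1), and the
factor X - ω^j of the check polynomial cancels the denominator. -/
lemma monomial_word_mem_reedSolomonCode (hω : IsPrimitiveRoot ω n) {j : ℕ} (hj : j < d) :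
    (fun i : Fin n => (ω⁻¹ ^ (i : ℕ)) ^ j) ∈ reedSolomonCode ω n d := by
  rcases Nat.eq_zero_or_pos n with rfl | hn
  · convert Submodule.zero_mem _
  have hω0 : ω ≠ 0 := hω.ne_zero hn.ne'
  change (X ^ n - 1 : F[X]) ∣ _ * _
  have hgeom := mul_geom_sum (C (ω⁻¹ ^ j) * X : F[X]) n
  have hpow : (C (ω⁻¹ ^ j) * X : F[X]) ^ n = X ^ n := by
    rw [mul_pow, ← C_pow, ← pow_mul, mul_comm j, pow_mul, inv_pow ω n, hω.pow_eq_one]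
    simp
  have hsum : ∑ i : Fin n, C ((ω⁻¹ ^ (i : ℕ)) ^ j) * X ^ (i : ℕ) =
      ∑ i ∈ Finset.range n, (C (ω⁻¹ ^ j) * X : F[X]) ^ i := by
    rw [← Fin.sum_univ_eq_sum_range (fun i => (C (ω⁻¹ ^ j) * X : F[X]) ^ i)]
    refine Finset.sum_congr rfl fun i _ => ?_
    rw [mul_pow, ← C_pow, ← pow_mul, ← pow_mul, mul_comm j]
  have hfac : (X - C (ω ^ j) : F[X]) = C (ω ^ j) * (C (ω⁻¹ ^ j) * X - 1) := by
    rw [mul_sub, ← mul_assoc, ← C_mul, ← mul_pow, mul_inv_cancel₀ hω0]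
    simp
  rw [hsum, ← Finset.mul_prod_erase _ _ (Finset.mem_range.2 hj), hfac]
  refine ⟨C (ω ^ j) * ∏ i ∈ (Finset.range d).erase j, (X - C (ω ^ i)), ?_⟩
  rw [hpow] at hgeom
  rw [← hgeom]
  ring

/-- Reed-Solomon codes are evaluation codes. -/
lemma mem_reedSolomonCode_iff (hω : IsPrimitiveRoot ω n) (hn : (n : F) ≠ 0) (hd0 : 0 < d) (hd : d ≤ n)
    {a : Fin n → F} :
    a ∈ reedSolomonCode ω n d ↔
      ∃ p : F[X], p.natDegree < d ∧ ∀ i : Fin n, a i = p.eval (ω⁻¹ ^ (i : ℕ)) := by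
  have hn0 : n ≠ 0 := by rintro rfl; simp at hn
  have hω0 : ω ≠ 0 := hω.ne_zero hn0
  constructor
  · intro ha
    set A : F[X] := ∑ i : Fin n, C (a i) * X ^ (i : ℕ) with hA
    have hAeval : ∀ y, A.eval y = ∑ i : Fin n, a i * y ^ (i : ℕ) := fun y => by
      simp [hA, eval_finsetSum]
    -- The check polynomial is nonzero at ω^j for d ≤ j < n, so the Fourier transform of `a` is
    -- supported on [0, d). Fourier inversion then gives the polynomial to be evaluated.
    have hzero : ∀ j ∈ Finset.range n, j ∉ Finset.range d → A.eval (ω ^ j) = 0 := by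
      intro j hj hjd
      obtain ⟨B, hB⟩ : (X ^ n - 1 : F[X]) ∣ (∏ i ∈ Finset.range d, (X - C (ω ^ i))) * A := ha
      have h1 := congrArg (eval (ω ^ j)) hB
      rw [eval_mul, eval_mul, eval_sub, eval_pow, eval_X, eval_one, ← pow_mul, mul_comm j, pow_mul,
        hω.pow_eq_one, one_pow, sub_self, zero_mul, eval_prod] at h1
      refine (mul_eq_zero.1 h1).resolve_left (Finset.prod_ne_zero_iff.2 fun i hi => ?_)
      rw [Finset.mem_range] at hi hj hjd
      simp only [eval_sub, eval_X, eval_C]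
      exact sub_ne_zero.2 fun h => by
        have := hω.pow_inj hj (hi.trans_le hd) h
        omega
    refine ⟨∑ j ∈ Finset.range d, C ((n : F)⁻¹ * A.eval (ω ^ j)) * X ^ j, ?_, fun i => ?_⟩
    · rw [Nat.lt_iff_le_pred hd0]
      refine natDegree_sum_le_of_forall_le _ _ fun j hj => (natDegree_C_mul_X_pow_le _ _).trans ?_
      have := Finset.mem_range.1 hj
      omega
    · simp only [eval_finsetSum, eval_mul, eval_C, eval_pow, eval_X]
      rw [Finset.sum_subset (Finset.range_subset_range.2 hd) fun j hj hjd => by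
        rw [hzero j hj hjd, mul_zero, zero_mul]]
      simp only [hAeval, mul_assoc, ← Finset.mul_sum, Finset.sum_mul]
      rw [Finset.sum_comm]
      have horth : ∀ l : Fin n, ∑ j ∈ Finset.range n,
          a l * ((ω ^ j) ^ (l : ℕ) * (ω⁻¹ ^ (i : ℕ)) ^ j) = if l = i then n * a i else 0 := by
        intro l
        have : ∀ j, (ω ^ j) ^ (l : ℕ) * (ω⁻¹ ^ (i : ℕ)) ^ j =
            (ω ^ (l : ℕ) * ω⁻¹ ^ (i : ℕ)) ^ j := fun j => by
          rw [mul_pow, ← pow_mul, ← pow_mul, mul_comm j, pow_mul]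
        simp only [this, ← Finset.mul_sum]
        split_ifs with h
        · rw [h, ← mul_pow, mul_inv_cancel₀ hω0]
          simp [mul_comm]
        · rw [sum_pow_eq_zero_of_pow_eq_one, mul_zero]
          · rw [mul_pow, ← pow_mul, ← pow_mul, mul_comm _ n, mul_comm _ n, pow_mul, pow_mul,
              inv_pow ω n, hω.pow_eq_one]
            simp
          · intro h1
            rw [inv_pow, mul_inv_eq_one₀ (pow_ne_zero _ hω0)] at h1
            exact h (Fin.ext (hω.pow_inj l.2 i.2 h1))
      rw [Finset.sum_congr rfl fun l _ => horth l]
      simp [hn]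
  · rintro ⟨p, hp, hpa⟩
    have : a = ∑ j ∈ Finset.range d, p.coeff j • fun i : Fin n => (ω⁻¹ ^ (i : ℕ)) ^ j := by
      ext i
      rw [hpa]
      conv_lhs => rw [p.as_sum_range_C_mul_X_pow' hp]
      simp [eval_finsetSum]
    rw [this]
    exact Submodule.sum_mem _ fun j hj =>
      Submodule.smul_mem _ _ (monomial_word_mem_reedSolomonCode hω (Finset.mem_range.1 hj))

lemma IsPrimitiveRoot.injective_inv_pow (hω : IsPrimitiveRoot ω n) :
    Function.Injective fun i : Fin n => ω⁻¹ ^ (i : ℕ) := fun i j hij =>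
  Fin.ext (hω.inv.pow_inj i.2 j.2 hij)

lemma isMDS_reedSolomonCode (hω : IsPrimitiveRoot ω n) (hn : (n : F) ≠ 0) (hd0 : 0 < d) (hd : d ≤ n) :
    IsMDS (reedSolomonCode ω n d) d where
  eq_zero c hc S hS hcS := by
    obtain ⟨p, hp, hpc⟩ := (mem_reedSolomonCode_iff hω hn hd0 hd).1 hc
    have hp0 : p = 0 := eq_zero_of_degree_lt_of_eval_index_eq_zero
      (s := S)
      (v := fun i : Fin n => ω⁻¹ ^ (i : ℕ)) hω.injective_inv_pow.injOn
      (degree_le_natDegree.trans_lt (by exact_mod_cast hp.trans_le hS))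
      fun i hi => by rw [← hpc, hcS i hi]
    ext i
    rw [hpc, hp0, eval_zero, Pi.zero_apply]
  exists_interpolation S hS g := by
    classical
    refine ⟨fun i => (Lagrange.interpolate S (fun i : Fin n => ω⁻¹ ^ (i : ℕ)) g).eval
      (ω⁻¹ ^ (i : ℕ)), (mem_reedSolomonCode_iff hω hn hd0 hd).2 ⟨_, ?_, fun i => rfl⟩, fun i hi => ?_⟩
    · rw [Nat.lt_iff_le_pred hd0]
      exact natDegree_le_of_degree_le ((Lagrange.degree_interpolate_le _
        hω.injective_inv_pow.injOn).trans_eq (by rw [hS]))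
    · exact Lagrange.eval_interpolate_at_node (v := fun i : Fin n => ω⁻¹ ^ (i : ℕ)) _
        hω.injective_inv_pow.injOn hi

lemma isLineTestable_reedSolomonCode [DecidableEq F] (hω : IsPrimitiveRoot ω n)
    (hn : (n : F) ≠ 0) (hd0 : 0 < d) (hd : 3 * d ≤ n) (m : ℕ) :
    IsLineTestable (reedSolomonCode ω n d) (m + 2) (lineTestConst m) := by
  have hC := isMDS_reedSolomonCode hω hn hd0 (by omega)
  refine IsLineTestable.of_two hC (by omega)
    (isLineTestable_two hC hd hd0 hω.injective_inv_pow fun c hc => ?_) m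
  obtain ⟨p, hp, hpc⟩ := (mem_reedSolomonCode_iff hω hn hd0 (by omega)).1 hc
  exact ⟨p, hp, hpc⟩

end ReedSolomon

/-! ### Flats and weights -/

section Weights

variable {F : Type*} [Field F]

lemma relWeight_eq [DecidableEq F] {X : Type*} [Fintype X] (f : X → F) :
    relWeight f = (hammingNorm f : ℝ) / Fintype.card X := by
  rw [relWeight]
  congr!

lemma relWeight_sub_eq [DecidableEq F] {X : Type*} [Fintype X] (f g : X → F) :
    relWeight (f - g) = (hammingDist f g : ℝ) / Fintype.card X := by
  rw [relWeight_eq, hammingDist_comm, hammingDist_eq_hammingNorm, neg_add_eq_sub]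

lemma relWeight_nonneg {X : Type*} [Fintype X] (f : X → F) : 0 ≤ relWeight f := by
  unfold relWeight
  positivity

lemma relDist_le {X : Type*} [Fintype X] (f : X → F) {D : Set (X → F)} {g : X → F} (hg : g ∈ D) :
    relDist f D ≤ relWeight (f - g) :=
  ciInf_le (f := fun y : D => relWeight (f - (y : X → F)))
    ⟨0, by rintro _ ⟨y, rfl⟩; exact relWeight_nonneg _⟩ ⟨g, hg⟩

lemma exists_relDist_eq [Finite F] {X : Type*} [Fintype X] (f : X → F) {D : Set (X → F)}
    (hD : D.Nonempty) : ∃ g ∈ D, relDist f D = relWeight (f - g) := by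
  have : Nonempty D := hD.to_subtype
  obtain ⟨y, hy⟩ := exists_eq_ciInf_of_finite (f := fun y : D => relWeight (f - (y : X → F)))
  exact ⟨y, y.2, hy.symm⟩

variable {n m d : ℕ} {C : Submodule F (Fin n → F)}

lemma mem_axisFlat {I : Finset (Fin m)} {x y : Fin m → Fin n} :
    y ∈ axisFlat (n := fun _ => n) I x ↔ ∀ j ∉ I, y j = x j := by
  simp [axisFlat]

lemma axisFlat_eq_iff {I : Finset (Fin m)} {x y : Fin m → Fin n} :
    axisFlat (n := fun _ => n) I y = axisFlat I x ↔ y ∈ axisFlat (n := fun _ => n) I x := by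
  constructor
  · intro h
    rw [← h, mem_axisFlat]
    exact fun _ _ => rfl
  · intro h
    rw [mem_axisFlat] at h
    ext z
    rw [mem_axisFlat, mem_axisFlat]
    exact forall₂_congr fun j hj => by rw [h j hj]

/-- The flats in given directions partition the grid. -/
lemma sum_flatsAlong {M : Type*} [AddCommMonoid M] (I : Finset (Fin m))
    (φ : (Fin m → Fin n) → M) :
    ∑ J ∈ flatsAlong (fun _ : Fin m => n) I, ∑ x ∈ J, φ x = ∑ x, φ x := by
  rw [← Finset.sum_fiberwise_of_maps_to (s := Finset.univ)
    (t := flatsAlong (fun _ : Fin m => n) I) (g := axisFlat I)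
    fun x _ => Finset.mem_image_of_mem _ (Finset.mem_univ x)]
  refine Finset.sum_congr rfl fun J hJ => Finset.sum_congr ?_ fun _ _ => rfl
  obtain ⟨y, -, rfl⟩ := Finset.mem_image.1 hJ
  ext x
  simp [axisFlat_eq_iff]

lemma card_axisFlat_singleton (i : Fin m) (x : Fin m → Fin n) :
    (axisFlat (n := fun _ => n) {i} x).card = n := by
  classical
  have : axisFlat (n := fun _ => n) {i} x = Finset.univ.image (Function.update x i) := by
    ext y
    simp only [mem_axisFlat, Finset.mem_singleton, Finset.mem_image, Finset.mem_univ, true_and]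
    constructor
    · intro h
      refine ⟨y i, ?_⟩
      ext j
      by_cases hj : j = i
      · subst hj; simp
      · simp [hj, h j hj]
    · rintro ⟨s, rfl⟩ j hj
      simp [hj]
  rw [this, Finset.card_image_of_injective _ (Function.update_injective x i), Finset.card_univ,
    Fintype.card_fin]

lemma card_flatsAlong_singleton (i : Fin m) :
    (flatsAlong (fun _ : Fin m => n) {i}).card * n = n ^ m := by
  have h := sum_flatsAlong (n := n) {i} fun _ => 1
  simp only [Finset.sum_const, smul_eq_mul, mul_one, Finset.card_univ, Fintype.card_pi,
    Fintype.card_fin, Finset.prod_const] at h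
  rw [← h, Finset.sum_const_nat]
  intro J hJ
  obtain ⟨y, -, rfl⟩ := Finset.mem_image.1 hJ
  exact card_axisFlat_singleton i y

open Classical in
/-- The lines in direction `i` on which the word `a` does not vanish. -/
def nonzeroLines (i : Fin m) (a : (Fin m → Fin n) → F) : Finset (Finset (Fin m → Fin n)) :=
  (flatsAlong (fun _ : Fin m => n) {i}).filter fun l => restrictWord l a ≠ 0

lemma mem_nonzeroLines {i : Fin m} {a : (Fin m → Fin n) → F} {l : Finset (Fin m → Fin n)} :
    l ∈ nonzeroLines i a ↔ ∃ x, axisFlat (n := fun _ => n) {i} x = l ∧ a x ≠ 0 := by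
  simp only [nonzeroLines, Finset.mem_filter, flatsAlong, Finset.mem_image, Finset.mem_univ,
    true_and]
  constructor
  · rintro ⟨⟨x, rfl⟩, h⟩
    obtain ⟨y, hy⟩ := Function.ne_iff.1 h
    exact ⟨y, axisFlat_eq_iff.2 y.2, hy⟩
  · rintro ⟨x, rfl, hx⟩
    exact ⟨⟨x, rfl⟩, fun h => hx (congrFun h ⟨x, mem_axisFlat.2 fun _ _ => rfl⟩)⟩

lemma nonzeroLines_subset (i : Fin m) (a : (Fin m → Fin n) → F) :
    nonzeroLines i a ⊆ flatsAlong (fun _ : Fin m => n) {i} := by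
  classical
  exact Finset.filter_subset _ _

lemma lineWeight_eq (hn : 0 < n) (i : Fin m) (a : (Fin m → Fin n) → F) :
    lineWeight (n := fun _ => n) i a = (nonzeroLines i a).card * n / (n : ℝ) ^ m := by
  have h : ((flatsAlong (fun _ : Fin m => n) {i}).card : ℝ) * n = (n : ℝ) ^ m := by
    exact_mod_cast card_flatsAlong_singleton i
  have hn' : (n : ℝ) ≠ 0 := by positivity
  rw [← h, mul_div_mul_right _ _ hn']
  rfl

/-- A nonzero codeword of `C` has at least n/2 nonzero entries, which turns Hamming bounds into
bounds on line weights. -/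
lemma IsMDS.card_nonzeroLines_mul_le [DecidableEq F] (hC : IsMDS C d) (hd : 2 * d ≤ n)
    {i : Fin m} {a : (Fin m → Fin n) → F} (ha : a ∈ axisPow C m i) :
    (nonzeroLines i a).card * n ≤ 2 * hammingNorm a := by
  classical
  have hline : ∀ l ∈ nonzeroLines i a, n ≤ 2 * ∑ x ∈ l, if a x ≠ 0 then 1 else 0 := by
    intro l hl
    obtain ⟨x, rfl, hx⟩ := mem_nonzeroLines.1 hl
    have := hC.pow_le_card_of_ne_zero hd {i} (by simpa using ha) x hx
    rw [Finset.card_singleton, pow_one, pow_one] at this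
    rw [← Finset.card_filter]
    refine this.trans (Nat.mul_le_mul_left _ (Finset.card_le_card fun y hy => ?_))
    simpa [mem_axisFlat] using hy
  calc (nonzeroLines i a).card * n = ∑ l ∈ nonzeroLines i a, n := by
        rw [Finset.sum_const, smul_eq_mul]
    _ ≤ ∑ l ∈ nonzeroLines i a, 2 * ∑ x ∈ l, if a x ≠ 0 then 1 else 0 := Finset.sum_le_sum hline
    _ ≤ ∑ l ∈ flatsAlong (fun _ : Fin m => n) {i}, 2 * ∑ x ∈ l, if a x ≠ 0 then 1 else 0 :=
      Finset.sum_le_sum_of_subset (nonzeroLines_subset i a)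
    _ = 2 * hammingNorm a := by
      rw [← Finset.mul_sum, sum_flatsAlong, ← Finset.card_filter, hammingNorm]

/-- If each line contains at most one point of the support of `c`, then a decomposition of `c`
uses at least as many lines as `c` has non-zero entries. -/
lemma hammingNorm_le_sum_card_nonzeroLines [DecidableEq F] {c : (Fin m → Fin n) → F}
    (hc : ∀ x i s, c x ≠ 0 → c (Function.update x i s) ≠ 0 → s = x i)
    {a : Fin m → (Fin m → Fin n) → F} (hca : c = ∑ i, a i) :
    hammingNorm c ≤ ∑ i, (nonzeroLines i (a i)).card := by
  classical
  have hex : ∀ x, c x ≠ 0 → ∃ i, a i x ≠ 0 := by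
    intro x hx
    by_contra! h
    exact hx (by simp [hca, h])
  by_cases hc0 : c = 0
  · simp [hc0]
  have : Nonempty (Fin m) := (Function.ne_iff.1 hc0).elim fun x hx => ⟨(hex x hx).choose⟩
  choose! ι hι using hex
  rw [hammingNorm, ← Finset.card_sigma]
  -- A support point x is sent to a direction whose summand is nonzero at x, with the line through x
  -- in that direction. The line recovers x, since it meets the support only once.
  refine Finset.card_le_card_of_injOn (fun x => ⟨ι x, axisFlat {ι x} x⟩) ?_ ?_
  · intro x hx
    simp only [Finset.coe_filter, Finset.mem_univ, true_and, Set.mem_ofPred_eq] at hx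
    simpa using mem_nonzeroLines.2 ⟨x, rfl, hι x hx⟩
  · intro x hx y hy hxy
    simp only [Finset.coe_filter, Finset.mem_univ, true_and, Set.mem_ofPred_eq] at hx hy
    simp only [Sigma.mk.injEq] at hxy
    obtain ⟨h1, h2⟩ := hxy
    rw [← h1] at h2
    have h3 := axisFlat_eq_iff.1 (eq_of_heq h2)
    rw [mem_axisFlat] at h3
    have hupd : Function.update x (ι x) (y (ι x)) = y := by
      ext j
      by_cases hj : j = ι x
      · subst hj; simp
      · rw [Function.update_of_ne hj, h3 j (by simpa using hj)]
    have := hc x (ι x) (y (ι x)) hx (by rwa [hupd])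
    rw [← hupd, this, Function.update_eq_self]

end Weights

/-! ### Robustness and agreement testability from the line test -/

section Testability

variable {F : Type*} [Field F] {n m d : ℕ} {C : Submodule F (Fin n → F)}

lemma isGreatest_sSup_of_isClosed {S : Set ℝ} (h : IsClosed S) (hne : S.Nonempty)
    (hb : BddAbove S) : IsGreatest S (sSup S) :=
  ⟨h.csSup_mem hne hb, fun _ => le_csSup hb⟩

/-- A finite union of closed sets. Finiteness of the field enters here: with finitely many
witnesses, the suprema over product-expansion and agreement constants are attained. -/
lemma isClosed_setOf_exists_mul_le {ι : Type*} [Finite ι] (P : ι → Prop) (f g : ι → ℝ) :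
    IsClosed {α : ℝ | ∃ i, P i ∧ α * f i ≤ g i} := by
  have : {α : ℝ | ∃ i, P i ∧ α * f i ≤ g i} = ⋃ i ∈ {i | P i}, {α : ℝ | α * f i ≤ g i} := by
    ext α
    simp
  rw [this]
  exact (Set.toFinite _).isClosed_biUnion fun i _ =>
    isClosed_le (by fun_prop) continuous_const

lemma le_div_of_mul_le_of_le {α x y δ : ℝ} (h : α * x ≤ y) (hδ : 0 < δ) (hx : δ ≤ x) (hy : 0 ≤ y) :
    α ≤ y / δ := by
  rw [le_div_iff₀ hδ]
  rcases le_total α 0 with hα | hα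
  · exact (mul_nonpos_of_nonpos_of_nonneg hα hδ.le).trans hy
  · exact (mul_le_mul_of_nonneg_left hx hα).trans h

lemma IsMDS.exists_ne_zero (hC : IsMDS C d) (hd0 : 0 < d) (hdn : d ≤ n) : ∃ a ∈ C, a ≠ 0 := by
  obtain ⟨S, -, hS⟩ := Finset.exists_subset_card_eq (s := (Finset.univ : Finset (Fin n)))
    (n := d) (by simpa using hdn)
  obtain ⟨a, ha, haS⟩ := hC.exists_interpolation S hS 1
  obtain ⟨i, hi⟩ := Finset.card_pos.1 (hS ▸ hd0)
  exact ⟨a, ha, Function.ne_iff.2 ⟨i, by simp [haS i hi]⟩⟩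

lemma IsMDS.exists_notMem_tensorPow (hC : IsMDS C d) (hdn : d < n) (hm : 0 < m) :
    ∃ c : (Fin m → Fin n) → F, c ∉ tensorPow C m := by
  classical
  let x : Fin m → Fin n := fun _ => ⟨0, by omega⟩
  refine ⟨Pi.single x 1, fun h => ?_⟩
  have := hC.eq_of_agree_on_line (mem_tensorPow.1 h ⟨0, hm⟩) (Submodule.zero_mem _) x
    (Finset.univ.erase (x ⟨0, hm⟩)) (by
      rw [Finset.card_erase_of_mem (Finset.mem_univ _), Finset.card_univ, Fintype.card_fin]
      omega) (fun s hs => by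
      rw [Pi.single_eq_of_ne, Pi.zero_apply]
      intro heq
      apply Finset.ne_of_mem_erase hs
      rw [← heq, Function.update_self])
  simp at this

/-- Line testability implies agreement testability. -/
lemma IsLineTestable.isAgreementTestable [DecidableEq F] (hC : IsMDS C d) (hd : 2 * d ≤ n)
    (hn : 0 < n) (hm : 0 < m) {K : ℕ} (hK : IsLineTestable C m K) :
    IsAgreementTestable (fun _ : Fin m => C) (1 / (2 * (K + 1) * (m : ℝ) ^ 2)) := by
  intro c hc
  -- The first word of the family plays the role of the tested word.
  obtain ⟨z, hz, hzK⟩ := hK (c ⟨0, hm⟩) c hc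
  refine ⟨z, hz, ?_⟩
  set E : ℕ := ∑ i, ∑ j, hammingDist (c i) (c j) with hE
  have h0 : ∑ j, hammingDist (c ⟨0, hm⟩) (c j) ≤ E :=
    Finset.single_le_sum (f := fun i => ∑ j, hammingDist (c i) (c j))
      (fun _ _ => Nat.zero_le _) (Finset.mem_univ _)
  have hj : ∀ j, hammingDist (c j) z ≤ (K + 1) * E := by
    intro j
    have h1 : hammingDist (c ⟨0, hm⟩) (c j) ≤ ∑ j, hammingDist (c ⟨0, hm⟩) (c j) :=
      Finset.single_le_sum (f := fun j => hammingDist (c ⟨0, hm⟩) (c j))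
        (fun _ _ => Nat.zero_le _) (Finset.mem_univ _)
    calc hammingDist (c j) z ≤ hammingDist (c ⟨0, hm⟩) (c j) + hammingDist (c ⟨0, hm⟩) z :=
          hammingDist_triangle_left _ _ _
      _ ≤ E + K * E := add_le_add (h1.trans h0) (hzK.trans (Nat.mul_le_mul_left _ h0))
      _ = _ := by ring
  have hN : ∑ i, (nonzeroLines i (c i - z)).card * n ≤ m * (2 * ((K + 1) * E)) := by
    calc _ ≤ ∑ _i : Fin m, 2 * ((K + 1) * E) := Finset.sum_le_sum fun i _ => by
          refine (hC.card_nonzeroLines_mul_le hd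
            (Submodule.sub_mem _ (hc i) (mem_tensorPow.1 hz i))).trans (Nat.mul_le_mul_left _ ?_)
          rw [← neg_add_eq_sub, ← hammingDist_eq_hammingNorm, hammingDist_comm]
          exact hj i
      _ = _ := by simp
  have hlw : ∑ i, lineWeight (n := fun _ => n) i (c i - z) =
      ((∑ i, (nonzeroLines i (c i - z)).card * n : ℕ) : ℝ) / (n : ℝ) ^ m := by
    push_cast
    rw [Finset.sum_div]
    exact Finset.sum_congr rfl fun i _ => lineWeight_eq hn i _
  have hrw : ∑ i, ∑ j, relWeight (c i - c j) = (E : ℝ) / (n : ℝ) ^ m := by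
    rw [hE]
    push_cast
    rw [Finset.sum_div]
    refine Finset.sum_congr rfl fun i _ => ?_
    rw [Finset.sum_div]
    refine Finset.sum_congr rfl fun j _ => ?_
    rw [relWeight_sub_eq]
    simp
  have hm' : (0 : ℝ) < m := by exact_mod_cast hm
  have hn' : (0 : ℝ) < (n : ℝ) ^ m := by positivity
  rw [hlw, hrw]
  have hN' : ((∑ i, (nonzeroLines i (c i - z)).card * n : ℕ) : ℝ) ≤ m * (2 * ((K + 1) * E)) := by
    exact_mod_cast hN
  calc _ ≤ 1 / (2 * (K + 1) * (m : ℝ) ^ 2) * ((m * (2 * ((K + 1) * E))) / (n : ℝ) ^ m / m) := by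
        gcongr
    _ = _ := by
      field_simp

/-- In a family with one nonzero member and the others 0, no single z equals all members. Some c i -
z is nonzero on at least one line, which bounds α. -/
lemma IsMDS.bddAbove_isAgreementTestable (hC : IsMDS C d) (hd0 : 0 < d) (hdn : d ≤ n)
    (hm : 2 ≤ m) : BddAbove {α : ℝ | IsAgreementTestable (fun _ : Fin m => C) α} := by
  classical
  have hn : 0 < n := by omega
  obtain ⟨a, ha, ha0⟩ := hC.exists_ne_zero hd0 hdn
  let i₀ : Fin m := ⟨0, by omega⟩
  let i₁ : Fin m := ⟨1, by omega⟩
  have hi : i₁ ≠ i₀ := by simp [i₀, i₁]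
  let c : Fin m → (Fin m → Fin n) → F := Pi.single i₀ fun x => a (x i₀)
  have hc : ∀ i, c i ∈ axisPow C m i := by
    intro i
    by_cases h : i = i₀
    · subst h
      intro x
      simpa [c] using ha
    · simp [c, h]
  have hc0 : c i₀ ≠ 0 := by
    obtain ⟨s, hs⟩ := Function.ne_iff.1 ha0
    exact Function.ne_iff.2 ⟨fun _ => s, by simpa [c] using hs⟩
  have hc1 : c i₁ = 0 := by simp [c, hi]
  refine ⟨(∑ i, ∑ j, relWeight (c i - c j)) / (m : ℝ) ^ 2 / (n / (n : ℝ) ^ m / m), fun α hα => ?_⟩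
  obtain ⟨z, -, hz⟩ := hα c hc
  have hne : ∃ i, c i - z ≠ 0 := by
    by_contra! h
    apply hc0
    rw [sub_eq_zero.1 (h i₀), ← sub_eq_zero.1 (h i₁), hc1]
  obtain ⟨i, hi⟩ := hne
  have hm' : (0 : ℝ) < m := by positivity
  refine le_div_of_mul_le_of_le hz (by positivity) ?_ ?_
  · have h1 : (n : ℝ) / (n : ℝ) ^ m ≤ lineWeight (n := fun _ => n) i (c i - z) := by
      rw [lineWeight_eq hn]
      obtain ⟨x, hx⟩ := Function.ne_iff.1 hi
      have : 1 ≤ (nonzeroLines i (c i - z)).card :=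
        Finset.card_pos.2 ⟨_, mem_nonzeroLines.2 ⟨x, rfl, hx⟩⟩
      gcongr
      exact le_mul_of_one_le_left (by positivity) (by exact_mod_cast this)
    have h2 : lineWeight (n := fun _ => n) i (c i - z) ≤
        ∑ i, lineWeight (n := fun _ => n) i (c i - z) :=
      Finset.single_le_sum (f := fun i => lineWeight (n := fun _ => n) i (c i - z))
        (fun i _ => by rw [lineWeight_eq hn]; positivity) (Finset.mem_univ i)
    gcongr
    exact h1.trans h2
  · have := fun i j => relWeight_nonneg (c i - c j)
    exact div_nonneg (Finset.sum_nonneg fun i _ => Finset.sum_nonneg fun j _ => this i j)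
      (by positivity)

lemma isClosed_isAgreementTestable [Finite F] :
    IsClosed {α : ℝ | IsAgreementTestable (fun _ : Fin m => C) α} := by
  simp only [IsAgreementTestable, Set.ofPred_forall]
  exact isClosed_iInter fun c => isClosed_iInter fun _ => isClosed_setOf_exists_mul_le _ _ _

lemma isGreatest_agreementTestability [Finite F] (hC : IsMDS C d) (hd0 : 0 < d) (hdn : d ≤ n)
    (hm : 2 ≤ m) {α : ℝ} (hα : IsAgreementTestable (fun _ : Fin m => C) α) :
    IsGreatest {α : ℝ | IsAgreementTestable (fun _ : Fin m => C) α}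
      (agreementTestability fun _ : Fin m => C) :=
  isGreatest_sSup_of_isClosed isClosed_isAgreementTestable ⟨α, hα⟩
    (hC.bddAbove_isAgreementTestable hd0 hdn hm)

lemma sum_biUnion_le_sum_sum {ι κ : Type*} [DecidableEq κ] (s : Finset ι) (t : ι → Finset κ)
    (f : κ → ℕ) : ∑ x ∈ s.biUnion t, f x ≤ ∑ i ∈ s, ∑ x ∈ t i, f x := by
  classical
  induction s using Finset.induction_on with
  | empty => simp
  | insert i s hi ih =>
    rw [Finset.biUnion_insert, Finset.sum_insert hi]
    have := Finset.sum_union_inter (s₁ := t i) (s₂ := s.biUnion t) (f := f)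
    omega

/-- Line testability implies robustness of the tests by flats. -/
lemma IsLineTestable.isRobustTest [DecidableEq F] [Finite F] (hn : 0 < n) (hm : 0 < m)
    {K : ℕ} (hK0 : 0 < K) (hK : IsLineTestable C m K) {k : ℕ} (hk : 1 ≤ k) (hkm : k ≤ m) :
    IsRobustTest (flatTest (fun _ : Fin m => n) k) (tensorPow C m : Set ((Fin m → Fin n) → F))
      (1 / (K * m * 2 ^ m)) := by
  classical
  intro c
  set T := flatTest (fun _ : Fin m => n) k with hT
  set D : Set ((Fin m → Fin n) → F) := ↑(tensorPow C m) with hD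
  have hDne : D.Nonempty := ⟨0, Submodule.zero_mem _⟩
  have hex : ∀ J : Finset (Fin m → Fin n), ∃ g ∈ tensorPow C m,
      relDist (restrictWord J c) (restrictCode J D) =
        relWeight (restrictWord J c - restrictWord J g) := by
    intro J
    obtain ⟨_, ⟨g, hg, rfl⟩, h⟩ := exists_relDist_eq (restrictWord J c)
      (D := restrictCode J D) (hDne.image _)
    exact ⟨g, hg, h⟩
  choose g hg hgdist using hex
  set e : Finset (Fin m → Fin n) → ℕ := fun J => ∑ x ∈ J, if c x ≠ g J x then 1 else 0 with he
  have hcarde : ∀ J, (J.card : ℝ) * relDist (restrictWord J c) (restrictCode J D) = e J := by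
    intro J
    have h1 : hammingDist (restrictWord J c) (restrictWord J (g J)) = e J := by
      rw [hammingDist, Finset.card_filter, he]
      exact Finset.sum_coe_sort J fun x => if c x ≠ g J x then 1 else 0
    rw [hgdist, relWeight_sub_eq, h1, Fintype.card_coe]
    rcases Finset.eq_empty_or_nonempty J with rfl | hJ
    · simp [he]
    · have : (J.card : ℝ) ≠ 0 := by
        have := Finset.card_pos.2 hJ
        positivity
      field_simp
  have hexp : testExpectation T (fun J => relDist (restrictWord J c) (restrictCode J D)) =
      ((∑ J ∈ T, e J : ℕ) : ℝ) / (∑ J ∈ T, J.card : ℕ) := by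
    push_cast
    rw [testExpectation, Finset.sum_div]
    refine Finset.sum_congr rfl fun J _ => ?_
    rw [← hcarde]
    ring
  have hflat : ∀ I ∈ Finset.powersetCard k (Finset.univ : Finset (Fin m)),
      ∑ J ∈ flatsAlong (fun _ : Fin m => n) I, J.card = n ^ m := by
    intro I _
    have := sum_flatsAlong (n := n) I fun _ => 1
    simpa using this
  -- A flat may arise from several direction sets but is counted once in `T`, so only an inequality
  -- is claimed.
  have htotal : ∑ J ∈ T, J.card ≤ 2 ^ m * n ^ m := by
    calc ∑ J ∈ T, J.card ≤ ∑ I ∈ Finset.powersetCard k (Finset.univ : Finset (Fin m)),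
          ∑ J ∈ flatsAlong (fun _ : Fin m => n) I, J.card := by
          rw [hT, flatTest]
          exact sum_biUnion_le_sum_sum _ _ _
      _ = m.choose k * n ^ m := by
          rw [Finset.sum_congr rfl hflat]
          simp
      _ ≤ _ := Nat.mul_le_mul_right _ (Nat.choose_le_two_pow m k)
  -- For a set I of k directions containing i, the nearest codewords on the flats along I are glued.
  -- Lines in direction i stay inside a flat, so the result lies in C^(i).
  have haxis : ∀ i : Fin m, ∃ a ∈ axisPow C m i, hammingDist c a ≤ ∑ J ∈ T, e J := by
    intro i
    obtain ⟨I, hiI, -, hI⟩ := Finset.exists_subsuperset_card_eq (Finset.subset_univ {i})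
      (by simpa using hk) (by simpa using hkm)
    have hiI' : i ∈ I := hiI (Finset.mem_singleton_self i)
    refine ⟨fun x => g (axisFlat I x) x, fun x => ?_, ?_⟩
    · have : ∀ s, axisFlat (n := fun _ => n) I (Function.update x i s) = axisFlat I x := by
        intro s
        rw [axisFlat_eq_iff, mem_axisFlat]
        intro j hj
        exact Function.update_of_ne (by rintro rfl; exact hj hiI') _ _
      simp only [this]
      exact mem_tensorPow.1 (hg (axisFlat I x)) i x
    · rw [hammingDist, Finset.card_filter, ← sum_flatsAlong I]
      calc _ = ∑ J ∈ flatsAlong (fun _ : Fin m => n) I, e J := by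
            refine Finset.sum_congr rfl fun J hJ => Finset.sum_congr rfl fun x hx => ?_
            obtain ⟨y, -, rfl⟩ := Finset.mem_image.1 hJ
            rw [axisFlat_eq_iff.2 hx]
        _ ≤ _ := Finset.sum_le_sum_of_subset fun J hJ => Finset.mem_biUnion.2
            ⟨I, by simpa [Finset.mem_powersetCard] using hI, hJ⟩
  choose a ha hae using haxis
  obtain ⟨z, hz, hcz⟩ := hK c a ha
  have hcz' : hammingDist c z ≤ K * (m * ∑ J ∈ T, e J) := by
    refine hcz.trans (Nat.mul_le_mul_left _ ((Finset.sum_le_sum fun i _ => hae i).trans_eq ?_))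
    simp
  have hdist : relDist c D ≤ (K * (m * (∑ J ∈ T, e J : ℕ)) : ℝ) / (n : ℝ) ^ m := by
    refine (relDist_le c hz).trans ?_
    rw [relWeight_sub_eq]
    simp only [Fintype.card_pi, Fintype.card_fin, Finset.prod_const, Finset.card_univ]
    push_cast
    gcongr
    exact_mod_cast hcz'
  have hm' : (0 : ℝ) < m := by exact_mod_cast hm
  have hK' : (0 : ℝ) < K := by exact_mod_cast hK0
  rw [hexp]
  calc _ ≤ 1 / (K * m * 2 ^ m) * ((K * (m * (∑ J ∈ T, e J : ℕ)) : ℝ) / (n : ℝ) ^ m) := by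
        gcongr
    _ = ((∑ J ∈ T, e J : ℕ) : ℝ) / (2 ^ m * n ^ m : ℕ) := by
        push_cast
        field_simp
    _ ≤ _ := by
        -- If all flats were empty, the right side would be 0/0, which is 0 by convention.
        rcases Nat.eq_zero_or_pos (∑ J ∈ T, J.card) with h | h
        · have : ∑ J ∈ T, e J = 0 := by
            refine Finset.sum_eq_zero fun J hJ => ?_
            have := Finset.sum_eq_zero_iff.1 h J hJ
            rw [Finset.card_eq_zero] at this
            rw [this]
            exact Finset.sum_empty
          rw [this, Nat.cast_zero, zero_div, zero_div]
        · exact div_le_div_of_nonneg_left (Nat.cast_nonneg _) (Nat.cast_pos.2 h)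
            (Nat.cast_le.2 htotal)

/-- A word at positive distance from the code, available because d < n, bounds the constants from
above. -/
lemma isGreatest_robustness [Finite F] (hC : IsMDS C d) (hdn : d < n) (hm : 0 < m)
    (T : Finset (Finset (Fin m → Fin n))) {α : ℝ}
    (hα : IsRobustTest T (tensorPow C m : Set ((Fin m → Fin n) → F)) α) :
    IsGreatest {α : ℝ | IsRobustTest T (tensorPow C m : Set ((Fin m → Fin n) → F)) α}
      (robustness T (tensorPow C m : Set ((Fin m → Fin n) → F))) := by
  classical
  refine isGreatest_sSup_of_isClosed ?_ ⟨α, hα⟩ ?_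
  · simp only [IsRobustTest, Set.ofPred_forall]
    exact isClosed_iInter fun c => isClosed_le (by fun_prop) continuous_const
  · obtain ⟨c, hc⟩ := hC.exists_notMem_tensorPow hdn hm
    have hpos : 0 < relDist c (tensorPow C m : Set ((Fin m → Fin n) → F)) := by
      obtain ⟨g, hg, h⟩ := exists_relDist_eq c (D := (tensorPow C m : Set ((Fin m → Fin n) → F)))
        ⟨0, Submodule.zero_mem _⟩
      have hcg : c ≠ g := fun h => hc (h ▸ hg)
      rw [h, relWeight_sub_eq]
      have h1 := hammingDist_pos.2 hcg
      have : Nonempty (Fin m → Fin n) := ⟨fun _ => ⟨0, by omega⟩⟩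
      positivity
    exact ⟨_, fun α hα => (le_div_iff₀ hpos).2 (hα c)⟩

end Testability

/-! ### Failure of product expansion -/

section ProductExpansion

variable {F : Type*} [Field F] {n m d : ℕ} {C : Submodule F (Fin n → F)} {ω : F}

/-- A word of the sum code whose support meets each line in at most one point bounds the product
expansion. -/
lemma IsProductExpanding.le_one_div (hn : 0 < n) {c : (Fin m → Fin n) → F}
    (hcC : c ∈ boxSumCode (n := fun _ : Fin m => n) fun _ => C) (hc0 : c ≠ 0)
    (hc : ∀ x i s, c x ≠ 0 → c (Function.update x i s) ≠ 0 → s = x i) {ρ : ℝ}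
    (hρ : IsProductExpanding (fun _ : Fin m => C) ρ) : ρ ≤ 1 / n := by
  classical
  obtain ⟨a, -, hca, ha⟩ := hρ c hcC
  have hN := hammingNorm_le_sum_card_nonzeroLines hc hca
  have hpos : 0 < hammingNorm c := hammingNorm_pos_iff.2 hc0
  set N := ∑ i, (nonzeroLines i (a i)).card with hNdef
  have hn' : (0 : ℝ) < n := by exact_mod_cast hn
  have hN0 : (0 : ℝ) < N := by exact_mod_cast hpos.trans_le hN
  have hsum : ∑ i, lineWeight (n := fun _ => n) i (a i) = N * n / (n : ℝ) ^ m := by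
    rw [hNdef]
    push_cast
    rw [Finset.sum_mul, Finset.sum_div]
    exact Finset.sum_congr rfl fun i _ => lineWeight_eq hn i _
  have hwt : relWeight c ≤ N / (n : ℝ) ^ m := by
    rw [relWeight_eq]
    simp only [Fintype.card_pi, Fintype.card_fin, Finset.prod_const, Finset.card_univ]
    push_cast
    gcongr
  rw [hsum] at ha
  -- With N lines used in total this reads ρ N n ≤ N.
  have h := ha.trans hwt
  rw [le_div_iff₀ hn']
  have hpow : (0 : ℝ) < (n : ℝ) ^ m := by positivity
  rw [← mul_div_assoc, div_le_div_iff_of_pos_right hpow] at h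
  refine le_of_mul_le_mul_left (h.trans_eq' ?_ |>.trans_eq (mul_one _).symm) hN0
  ring

/-- The restriction of a character of the grid to a subset of the grid where the coordinates other
than the first three vanish. -/
def charWord (ω : F) (n m : ℕ) (α β γ : ℕ) : (Fin (m + 3) → Fin n) → F := fun x =>
  if ∀ k : Fin (m + 3), 3 ≤ (k : ℕ) → (x k : ℕ) = 0 then
    (ω⁻¹ ^ (x ⟨0, by omega⟩ : ℕ)) ^ α * (ω⁻¹ ^ (x ⟨1, by omega⟩ : ℕ)) ^ β *
      (ω⁻¹ ^ (x ⟨2, by omega⟩ : ℕ)) ^ γ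
  else 0

lemma forall_update_iff {x : Fin (m + 3) → Fin n} {i : Fin (m + 3)} (hi : (i : ℕ) < 3)
    (s : Fin n) :
    (∀ k : Fin (m + 3), 3 ≤ (k : ℕ) → (Function.update x i s k : ℕ) = 0) ↔
      ∀ k : Fin (m + 3), 3 ≤ (k : ℕ) → (x k : ℕ) = 0 := by
  refine forall₂_congr fun k hk => ?_
  rw [Function.update_of_ne]
  rintro rfl
  omega

/-- The cut-off depends only on the coordinates from the fourth on, so along direction 0 the word is
0 or a multiple of one character. The same holds for directions 1 and 2 below. -/
lemma charWord_mem_axisPow_zero {α β γ : ℕ} (h : (fun i : Fin n => (ω⁻¹ ^ (i : ℕ)) ^ α) ∈ C) :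
    charWord ω n m α β γ ∈ axisPow C (m + 3) ⟨0, by omega⟩ := by
  intro x
  by_cases hx : ∀ k : Fin (m + 3), 3 ≤ (k : ℕ) → (x k : ℕ) = 0
  · convert C.smul_mem ((ω⁻¹ ^ (x ⟨1, by omega⟩ : ℕ)) ^ β * (ω⁻¹ ^ (x ⟨2, by omega⟩ : ℕ)) ^ γ) h
      using 1
    ext s
    simp only [charWord]
    rw [if_pos ((forall_update_iff (by simp) s).2 hx), Function.update_self,
      Function.update_of_ne (by simp), Function.update_of_ne (by simp), Pi.smul_apply, smul_eq_mul]
    ring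
  · convert C.zero_mem using 1
    ext s
    simp only [charWord]
    rw [if_neg (mt (forall_update_iff (by simp) s).1 hx), Pi.zero_apply]

lemma charWord_mem_axisPow_one {α β γ : ℕ} (h : (fun i : Fin n => (ω⁻¹ ^ (i : ℕ)) ^ β) ∈ C) :
    charWord ω n m α β γ ∈ axisPow C (m + 3) ⟨1, by omega⟩ := by
  intro x
  by_cases hx : ∀ k : Fin (m + 3), 3 ≤ (k : ℕ) → (x k : ℕ) = 0
  · convert C.smul_mem ((ω⁻¹ ^ (x ⟨0, by omega⟩ : ℕ)) ^ α * (ω⁻¹ ^ (x ⟨2, by omega⟩ : ℕ)) ^ γ) h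
      using 1
    ext s
    simp only [charWord]
    rw [if_pos ((forall_update_iff (by simp) s).2 hx), Function.update_self,
      Function.update_of_ne (by simp), Function.update_of_ne (by simp), Pi.smul_apply, smul_eq_mul]
    ring
  · convert C.zero_mem using 1
    ext s
    simp only [charWord]
    rw [if_neg (mt (forall_update_iff (by simp) s).1 hx), Pi.zero_apply]

lemma charWord_mem_axisPow_two {α β γ : ℕ} (h : (fun i : Fin n => (ω⁻¹ ^ (i : ℕ)) ^ γ) ∈ C) :
    charWord ω n m α β γ ∈ axisPow C (m + 3) ⟨2, by omega⟩ := by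
  intro x
  by_cases hx : ∀ k : Fin (m + 3), 3 ≤ (k : ℕ) → (x k : ℕ) = 0
  · convert C.smul_mem ((ω⁻¹ ^ (x ⟨0, by omega⟩ : ℕ)) ^ α * (ω⁻¹ ^ (x ⟨1, by omega⟩ : ℕ)) ^ β) h
      using 1
    ext s
    simp only [charWord]
    rw [if_pos ((forall_update_iff (by simp) s).2 hx), Function.update_self,
      Function.update_of_ne (by simp), Function.update_of_ne (by simp), Pi.smul_apply, smul_eq_mul]
  · convert C.zero_mem using 1
    ext s
    simp only [charWord]
    rw [if_neg (mt (forall_update_iff (by simp) s).1 hx), Pi.zero_apply]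

/-- A word supported on a surface that meets each line at most once. -/
def surfaceWord (ω : F) (n m d : ℕ) : (Fin (m + 3) → Fin n) → F :=
  ∑ e ∈ Finset.range n, charWord ω n m e (e + d) (e + 2 * d)

/-- The three thirds of the range of e are treated separately: e < d uses direction 0. For d ≤ e <
2d the exponent e + 2d lies in [n, n + d), and for 2d ≤ e < 3d so does e + d; characters have period
n in the exponent. -/
lemma surfaceWord_mem_boxSumCode (hω : IsPrimitiveRoot ω n) (hd : 3 * d = n) :
    surfaceWord ω n m d ∈
      boxSumCode (n := fun _ : Fin (m + 3) => n) fun _ => reedSolomonCode ω n d := by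
  have hmem : ∀ i (c : (Fin (m + 3) → Fin n) → F),
      c ∈ axisPow (reedSolomonCode ω n d) (m + 3) i →
      c ∈ boxSumCode (n := fun _ : Fin (m + 3) => n) fun _ => reedSolomonCode ω n d :=
    fun i c hc => Submodule.mem_iSup_of_mem i hc
  have hshift : ∀ e < d, (fun i : Fin n => (ω⁻¹ ^ (i : ℕ)) ^ (n + e)) ∈ reedSolomonCode ω n d := by
    intro e he
    convert monomial_word_mem_reedSolomonCode hω he using 2 with i
    rw [pow_add, ← pow_mul, mul_comm, mul_comm _ n, pow_mul, inv_pow ω n, hω.pow_eq_one]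
    simp
  have hrange : Finset.range n = Finset.range (d + d + d) := by rw [← hd]; congr 1; ring
  rw [surfaceWord, hrange, Finset.sum_range_add, Finset.sum_range_add]
  refine Submodule.add_mem _ (Submodule.add_mem _ ?_ ?_) ?_
  · refine Submodule.sum_mem _ fun e he => hmem _ _ (charWord_mem_axisPow_zero ?_)
    exact monomial_word_mem_reedSolomonCode hω (Finset.mem_range.1 he)
  · refine Submodule.sum_mem _ fun e he => hmem _ _ (charWord_mem_axisPow_two ?_)
    convert hshift e (Finset.mem_range.1 he) using 3
    omega
  · refine Submodule.sum_mem _ fun e he => hmem _ _ (charWord_mem_axisPow_one ?_)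
    convert hshift e (Finset.mem_range.1 he) using 3
    omega

/-- The remaining sum is geometric in an n-th root of unity, so it vanishes unless that root is 1;
this is the equation of the surface. -/
lemma surfaceWord_apply (x : Fin (m + 3) → Fin n) :
    surfaceWord ω n m d x = if ∀ k : Fin (m + 3), 3 ≤ (k : ℕ) → (x k : ℕ) = 0 then
      (ω⁻¹ ^ (x ⟨1, by omega⟩ : ℕ)) ^ d * (ω⁻¹ ^ (x ⟨2, by omega⟩ : ℕ)) ^ (2 * d) *
        ∑ e ∈ Finset.range n, (ω⁻¹ ^ (x ⟨0, by omega⟩ : ℕ) * ω⁻¹ ^ (x ⟨1, by omega⟩ : ℕ) *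
          ω⁻¹ ^ (x ⟨2, by omega⟩ : ℕ)) ^ e
      else 0 := by
  rw [surfaceWord, Finset.sum_apply]
  simp only [charWord]
  split_ifs
  · rw [Finset.mul_sum]
    refine Finset.sum_congr rfl fun e _ => ?_
    rw [pow_add, pow_add, mul_pow, mul_pow]
    ring
  · simp

lemma surfaceWord_ne_zero (hn : (n : F) ≠ 0) : surfaceWord ω n m d ≠ 0 := by
  have hn0 : 0 < n := Nat.pos_of_ne_zero (by rintro rfl; simp at hn)
  refine Function.ne_iff.2 ⟨fun _ => ⟨0, hn0⟩, ?_⟩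
  rw [surfaceWord_apply]
  simpa using hn

lemma surfaceWord_support (hω : IsPrimitiveRoot ω n) {x : Fin (m + 3) → Fin n}
    (hx : surfaceWord ω n m d x ≠ 0) :
    (∀ k : Fin (m + 3), 3 ≤ (k : ℕ) → (x k : ℕ) = 0) ∧
      ω⁻¹ ^ (x ⟨0, by omega⟩ : ℕ) * ω⁻¹ ^ (x ⟨1, by omega⟩ : ℕ) *
        ω⁻¹ ^ (x ⟨2, by omega⟩ : ℕ) = 1 := by
  rw [surfaceWord_apply] at hx
  split_ifs at hx with h
  refine ⟨h, ?_⟩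
  by_contra hne
  refine hx ?_
  rw [sum_pow_eq_zero_of_pow_eq_one ?_ hne, mul_zero]
  rw [← pow_add, ← pow_add, ← pow_mul, mul_comm, pow_mul, hω.inv.pow_eq_one, one_pow]
  · exact absurd rfl hx

/-- Any two of the first three coordinates determine the third on the surface, and all further
coordinates are 0 there. -/
lemma surfaceWord_eq_of_update_ne_zero (hω : IsPrimitiveRoot ω n) (x : Fin (m + 3) → Fin n)
    (i : Fin (m + 3)) (s : Fin n) (hx : surfaceWord ω n m d x ≠ 0)
    (hxs : surfaceWord ω n m d (Function.update x i s) ≠ 0) : s = x i := by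
  have hω0 : ω ≠ 0 := hω.ne_zero (by have := s.2; omega)
  have hpow : ∀ k : ℕ, ω⁻¹ ^ k ≠ 0 := fun k => pow_ne_zero _ (inv_ne_zero hω0)
  obtain ⟨hz, h1⟩ := surfaceWord_support hω hx
  obtain ⟨hzs, h1s⟩ := surfaceWord_support hω hxs
  by_cases hi : 3 ≤ (i : ℕ)
  · have h2 := hzs i hi
    rw [Function.update_self] at h2
    exact Fin.ext (h2.trans (hz i hi).symm)
  apply hω.injective_inv_pow
  have hcases : i = ⟨0, by simp⟩ ∨ i = ⟨1, by simp⟩ ∨ i = ⟨2, by simp⟩ := by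
    simp only [Fin.ext_iff]
    omega
  rw [← h1s] at h1
  rcases hcases with rfl | rfl | rfl
  · rw [Function.update_self, Function.update_of_ne (by simp), Function.update_of_ne (by simp)] at h1
    exact (mul_right_cancel₀ (hpow _) (mul_right_cancel₀ (hpow _) h1)).symm
  · rw [Function.update_self, Function.update_of_ne (by simp), Function.update_of_ne (by simp)] at h1
    exact (mul_left_cancel₀ (hpow _) (mul_right_cancel₀ (hpow _) h1)).symm
  · rw [Function.update_self, Function.update_of_ne (by simp), Function.update_of_ne (by simp)] at h1
    exact (mul_left_cancel₀ (mul_ne_zero (hpow _) (hpow _)) h1).symm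

lemma isProductExpanding_zero (C : Submodule F (Fin n → F)) (m : ℕ) :
    IsProductExpanding (fun _ : Fin m => C) 0 := by
  intro c hc
  obtain ⟨a, ha, rfl⟩ := (Submodule.mem_iSup_iff_exists_finsupp _ _).1 hc
  refine ⟨a, ha, ?_, ?_⟩
  · exact Finsupp.sum_fintype _ _ fun _ => rfl
  · rw [zero_mul]
    exact relWeight_nonneg _

lemma isClosed_isProductExpanding [Finite F] :
    IsClosed {ρ : ℝ | IsProductExpanding (fun _ : Fin m => C) ρ} := by
  simp only [IsProductExpanding, Set.ofPred_forall, ← and_assoc]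
  exact isClosed_iInter fun c => isClosed_iInter fun _ => isClosed_setOf_exists_mul_le _ _ _

lemma isGreatest_productExpansion_reedSolomonCode [Finite F] (hω : IsPrimitiveRoot ω n)
    (hn : (n : F) ≠ 0) (hd : 3 * d = n) (hm : 3 ≤ m) :
    IsGreatest {ρ : ℝ | IsProductExpanding (fun _ : Fin m => reedSolomonCode ω n d) ρ}
        (productExpansion fun _ : Fin m => reedSolomonCode ω n d) ∧
      productExpansion (fun _ : Fin m => reedSolomonCode ω n d) ≤ 1 / (n : ℝ) := by
  obtain ⟨m, rfl⟩ := Nat.exists_eq_add_of_le' hm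
  have hn0 : 0 < n := Nat.pos_of_ne_zero (by rintro rfl; simp at hn)
  have hle : ∀ ρ ∈ {ρ : ℝ | IsProductExpanding (fun _ : Fin (m + 3) => reedSolomonCode ω n d) ρ},
      ρ ≤ 1 / n := fun ρ hρ => IsProductExpanding.le_one_div hn0
    (surfaceWord_mem_boxSumCode hω hd) (surfaceWord_ne_zero hn)
    (surfaceWord_eq_of_update_ne_zero hω) hρ
  exact ⟨isGreatest_sSup_of_isClosed isClosed_isProductExpanding
    ⟨0, isProductExpanding_zero _ _⟩ ⟨_, hle⟩, csSup_le ⟨0, isProductExpanding_zero _ _⟩ hle⟩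

end ProductExpansion

/-! ### Specialization to fields with 2^(2t) elements -/

lemma natCast_two_pow_sub_one_ne_zero {F : Type*} [Field F] [Finite F] {t : ℕ}
    (h : Nat.card F = 2 ^ t) : ((2 ^ t - 1 : ℕ) : F) ≠ 0 := by
  intro h0
  have := Fintype.ofFinite F
  have h1 : ((2 ^ t - 1 + 1 : ℕ) : F) = 0 := by
    rw [Nat.sub_add_cancel Nat.one_le_two_pow, ← h, Nat.card_eq_fintype_card, Nat.cast_card_eq_zero]
  rw [Nat.cast_add, h0] at h1
  simp at h1

lemma lineTestConst_pos (m : ℕ) : 0 < lineTestConst m := by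
  induction m with
  | zero => simp [lineTestConst]
  | succ m ih => rw [lineTestConst]; omega

end

theorem theorem1 (m : ℕ) (hm : 3 ≤ m) :
    ∃ αr : ℝ, 0 < αr ∧ ∃ αa : ℝ, 0 < αa ∧
      ∀ t : ℕ, 1 ≤ t → ∀ (F : Type*) [Field F] [Finite F], Nat.card F = 2 ^ (2 * t) →
      ∀ n : ℕ, n = 2 ^ (2 * t) - 1 → ∀ ω : F, IsPrimitiveRoot ω n →
      ∀ Ct : Submodule F (Fin n → F), Ct = reedSolomonCode ω n (n / 3) →
        (IsGreatest {ρ : ℝ | IsProductExpanding (fun _ : Fin m => Ct) ρ}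
            (productExpansion fun _ : Fin m => Ct) ∧
          productExpansion (fun _ : Fin m => Ct) ≤ 1 / (n : ℝ)) ∧
        (∀ k : ℕ, 1 ≤ k → k ≤ m - 1 →
          IsGreatest {α : ℝ | IsRobustTest (flatTest (fun _ : Fin m => n) k)
              (productCode fun _ : Fin m => Ct : Set (Grid (fun _ : Fin m => n) → F)) α}
            (robustness (flatTest (fun _ : Fin m => n) k)
              (productCode fun _ : Fin m => Ct : Set (Grid (fun _ : Fin m => n) → F))) ∧
          αr ≤ robustness (flatTest (fun _ : Fin m => n) k)
              (productCode fun _ : Fin m => Ct : Set (Grid (fun _ : Fin m => n) → F))) ∧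
        (IsGreatest {α : ℝ | IsAgreementTestable (fun _ : Fin m => Ct) α}
            (agreementTestability fun _ : Fin m => Ct) ∧
          αa ≤ agreementTestability fun _ : Fin m => Ct) := by
  classical
  set K := lineTestConst (m - 2) with hKdef
  have hK0 : 0 < K := lineTestConst_pos _
  -- Both constants depend on m only, because `K` does.
  refine ⟨1 / (K * m * 2 ^ m), by positivity, 1 / (2 * (K + 1) * (m : ℝ) ^ 2), by positivity, ?_⟩
  rintro t ht F _ _ hF n hn ω hω _ rfl
  obtain ⟨d, hd⟩ : ∃ d, 3 * d = n := by
    have : 3 ∣ 4 ^ t - 1 ^ t := Nat.sub_dvd_pow_sub_pow 4 1 t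
    rw [hn, pow_mul]
    exact (by simpa using this : 3 ∣ 4 ^ t - 1).imp fun _ h => h.symm
  have hnF : (n : F) ≠ 0 := hn ▸ natCast_two_pow_sub_one_ne_zero hF
  have hn0 : 0 < n := Nat.pos_of_ne_zero (by rintro rfl; simp at hnF)
  have hnd : n / 3 = d := by omega
  have hd0 : 0 < d := by omega
  rw [hnd]
  have hC := isMDS_reedSolomonCode hω hnF hd0 (by omega)
  have hT : IsLineTestable (reedSolomonCode ω n d) m K := by
    have := isLineTestable_reedSolomonCode hω hnF hd0 hd.le (m - 2)
    rwa [Nat.sub_add_cancel (by omega)] at this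
  refine ⟨isGreatest_productExpansion_reedSolomonCode hω hnF hd hm, fun k hk hkm => ?_, ?_⟩
  · have hrob := hT.isRobustTest hn0 (by omega) hK0 hk (by omega)
    have hgreat := isGreatest_robustness hC (by omega) (by omega) _ hrob
    exact ⟨hgreat, hgreat.2 hrob⟩
  · have hagr := hT.isAgreementTestable hC (by omega) hn0 (by omega)
    have hgreat := isGreatest_agreementTestability hC hd0 (by omega) (by omega) hagr
    exact ⟨hgreat, hgreat.2 hagr⟩
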